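/- **Setting.** Let $\Theta\subset\mathbb R^3$ be a bounded domain and let $\mathbb H=L^2(\Theta)^3\times L^2(\Theta)^3$ be the real Hilbert space with its usual inner product and norm. The Maxwell operator is $M(\mathbf E,\mathbf H)=(\nabla\times\mathbf H,-\nabla\times\mathbf E)$ with domain $\mathcal D(M)=H_0(\mathrm{curl},\Theta)\times H(\mathrm{curl},\Theta)$, where the curl is taken in the sense of distributions and the condition $\mathbf n\times\mathbf E|_{\partial\Theta}=\mathbf 0$ in $H_0(\mathrm{curl},\Theta)$ is understood weakly, i.e. $\langle\nabla\times\mathbf E,\psi\rangle=\langle\mathbf E,\nabla\times\psi\rangle$ for all $\psi\in H(\mathrm{curl},\Theta)$. Let $Q$ be a bounded symmetric positive definite operator on $L^2(\Theta)$, let $U_0=Q^{1/2}(L^2(\Theta))$ with the inner product $\langle v,w\rangle_{U_0}=\langle Q^{-1/2}v,Q^{-1/2}w\rangle$, and let $W(t)=\sum_{j\ge1}\beta_j(t)Q^{1/2}e_j$ be a $Q$-Wiener process on a filtered probability space $(\Omega,\mathcal F,\{\mathcal F_t\}_{t\ge0},\mathbb P)$, where $(e_j)$ is an orthonormal basis of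 $L^2(\Theta)$ and $(\beta_j)$ are independent $\{\mathcal F_t\}$-adapted real Brownian motions whose increments after each time $s$ are jointly independent of $\mathcal F_s$. Let $F:\mathbb H\to\mathbb H$ and $B:\mathbb H\to HS(U_0;\mathbb H)$ be the Nemytskij operators $$F(h)(\mathbf x)=\begin{pmatrix}-\mathbf J_e(\mathbf x,h(\mathbf x))\\-\mathbf J_m(\mathbf x,h(\mathbf x))\end{pmatrix},\qquad (B(h)v)(\mathbf x)=\begin{pmatrix}-\mathbf J_e^r(\mathbf x,h(\mathbf x))\,v(\mathbf x)\\-\mathbf J_m^r(\mathbf x,h(\mathbf x))\,v(\mathbf x)\end{pmatrix},$$ where $\mathbf J_e,\mathbf J_m,\mathbf J_e^r,\mathbf J_m^r:\Theta\times\mathbb R^3\times\mathbb R^3\to\mathbb R^3$ and $\mathbf J_e,\mathbf J_m$ are Carathéodory functions (measurable in $\mathbf x$, continuous in the other variables for almost every $\mathbf x$). Assume that for some $\alpha_F,\alpha_B\in\mathbb R$ and all $u,v\in\mathbb H$, $$\langle u-v,F(u)-F(v)\rangle_{\mathbb H}\le\alpha_F\|u-v\|_{\mathbb H}^2,\qquad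 \|B(u)-B(v)\|_{HS(U_0;\mathbb H)}\le\alpha_B\|u-v\|_{\mathbb H}.$$ Put $\widetilde\alpha_F=\frac12\max\{1+2\alpha_F,\|F(0)\|_{\mathbb H}^2\}$, $\widetilde\alpha_B=\max\{\alpha_B,\|B(0)\|_{HS(U_0;\mathbb H)}\}$, and, for $p\ge2$ and $q\ge1$, $$\mathcal R_p=\Big(\tfrac{p(p-1)}2\big(\tfrac p{p-1}\big)^{p-2}\Big)^{1/2},$$ $$\widetilde{\mathcal R}_q=\big(1+4\widetilde\alpha_B\mathcal R_{2q}\big)^q+\sum_{i_1=0}^{q-1}\sum_{i_2=0}^{q-i_1-1}\binom q{i_1}\binom{q-i_1}{i_2}2^{3q-3i_1-i_2-1}\mathcal R_{2q}^{2q-2i_1-i_2}\,\widetilde\alpha_B^{\,2q-2i_1-i_2}.$$ **Statement.** Let $q\in\mathbb N$, $q\ge1$, let $u_0\in L^{2q}(\Omega;\mathbb H)$ be $\mathcal F_0$-measurable, and let $\sigma_0\in\mathbb R$ with $\sigma_0>\widetilde\alpha_F+\frac1q\widetilde{\mathcal R}_q$. For every step size $\Delta t>0$, with $t_k=k\Delta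 t$, the semi-implicit Euler scheme $$u_{k+1}-u_k=\Delta t\,Mu_{k+1}-\sigma_0\Delta t\,u_{k+1}+\Delta t\,F(u_{k+1})+B(u_k)\Delta W_k,\qquad k\ge0,$$ where $B(u_k)\Delta W_k=\sum_{j\ge1}(\beta_j(t_{k+1})-\beta_j(t_k))\,B(u_k)Q^{1/2}e_j$ (the series converging in probability), has an $\mathbb H$-valued $\{\mathcal F_{t_k}\}_{k\ge0}$-adapted solution $\{u_k\}_{k\ge0}$ with initial value $u_0$, and it is unique up to almost sure equality. Moreover there are constants $C>0$ and $\delta>0$, depending only on $\sigma_0,q,\widetilde\alpha_F$ and $\widetilde\alpha_B$, such that for all $\Delta t\in(0,\delta)$ $$\sup_{k\ge0}\mathbb E\big[\|u_k\|_{\mathbb H}^{2q}\big]<C\big(1+\mathbb E\big[\|u_0\|_{\mathbb H}^{2q}\big]\big).$$ -/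

import Mathlib

open MeasureTheory ProbabilityTheory Filter Topology
open scoped NNReal ENNReal

namespace StochMaxwell

noncomputable section

/-! ## The Hilbert space and the Maxwell operator -/

/-- Euclidean three-space. -/
abbrev E3 : Type := EuclideanSpace ℝ (Fin 3)

/-- `L²(Θ)³`. -/
abbrev VecL2 (Θ : Set E3) : Type := Lp E3 2 (volume.restrict Θ)

/-- `L²(Θ)`. -/
abbrev ScalarL2 (Θ : Set E3) : Type := Lp ℝ 2 (volume.restrict Θ)

/-- The real Hilbert space `ℍ = L²(Θ)³ × L²(Θ)³` of pairs (electric field, magnetic field), with the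
Hilbert (not the sup) norm of the product. -/
abbrev Fields (Θ : Set E3) : Type := WithLp 2 (VecL2 Θ × VecL2 Θ)

/-- The partial derivative `∂ᵢ φⱼ (x)`. -/
def partialDeriv (φ : E3 → E3) (i j : Fin 3) (x : E3) : ℝ :=
  fderiv ℝ φ x (EuclideanSpace.single i 1) j

/-- The classical curl of a differentiable vector field. -/
def curl (φ : E3 → E3) (x : E3) : E3 :=
  !₂[partialDeriv φ 1 2 x - partialDeriv φ 2 1 x,
     partialDeriv φ 2 0 x - partialDeriv φ 0 2 x,
     partialDeriv φ 0 1 x - partialDeriv φ 1 0 x]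

/-- `v ∈ H(curl, Θ)` and `∇ × v = w`, in the sense of distributions on `Θ`. -/
def HasWeakCurl {Θ : Set E3} (v w : VecL2 Θ) : Prop :=
  ∀ φ : E3 → E3, ContDiff ℝ (⊤ : ℕ∞) φ → HasCompactSupport φ → tsupport φ ⊆ Θ →
    ∫ x in Θ, inner ℝ (v x) (curl φ x) = ∫ x in Θ, inner ℝ (w x) (φ x)

/-- `v ∈ H₀(curl, Θ)` and `∇ × v = w`. The boundary condition `n × v = 0` on `∂Θ` is understood in
the usual weak sense, through Green's formula
`∫_Θ (∇ × v) · ψ - ∫_Θ v · (∇ × ψ) = ∫_∂Θ (n × v) · ψ` for `ψ ∈ H(curl, Θ)`. -/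
def HasWeakCurlZero {Θ : Set E3} (v w : VecL2 Θ) : Prop :=
  HasWeakCurl v w ∧ ∀ ψ χ : VecL2 Θ, HasWeakCurl ψ χ → inner ℝ w ψ = inner ℝ v χ

/-- The graph of the Maxwell operator: `u = (E, H)` lies in `D(M) = H₀(curl, Θ) × H(curl, Θ)` and
`M u = (∇ × H, -∇ × E)` equals `w`. -/
def IsMaxwell {Θ : Set E3} (u w : Fields Θ) : Prop :=
  HasWeakCurl u.snd w.fst ∧ HasWeakCurlZero u.fst (-w.snd)

/-! ## Nemytskij operators -/

/-- The Carathéodory conditions for `J : Θ × ℝ³ × ℝ³ → ℝ³`: measurable in the point of `Θ`,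
continuous in the remaining variables for almost every point. -/
structure IsCaratheodory (Θ : Set E3) (J : E3 → E3 → E3 → E3) : Prop where
  measurable : ∀ a b : E3, AEStronglyMeasurable (fun x => J x a b) (volume.restrict Θ)
  continuous : ∀ᵐ x ∂(volume.restrict Θ), Continuous (fun z : E3 × E3 => J x z.1 z.2)

/-- `F(h)(x) = (-Je(x, h₁(x), h₂(x)), -Jm(x, h₁(x), h₂(x)))`. -/
def IsDriftNemytskij {Θ : Set E3} (Je Jm : E3 → E3 → E3 → E3) (F : Fields Θ → Fields Θ) : Prop :=
  ∀ h : Fields Θ, ∀ᵐ x ∂(volume.restrict Θ),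
    (F h).fst x = -Je x (h.fst x) (h.snd x) ∧ (F h).snd x = -Jm x (h.fst x) (h.snd x)

/-! ## The covariance operator, the space `U₀ = Q^{1/2}(L²(Θ))` and Hilbert–Schmidt norms -/

/-- A (bounded) symmetric positive definite operator `Q` on a real Hilbert space `L`, together with
its square root, that is, with the (unique) positive operator whose square is `Q`. -/
structure Covariance (L : Type*) [NormedAddCommGroup L] [InnerProductSpace ℝ L] where
  op : L →L[ℝ] L
  symm : ∀ u v : L, inner ℝ (op u) v = inner ℝ u (op v)
  posDef : ∀ u : L, u ≠ 0 → 0 < inner ℝ (op u) u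
  sqrt : L →L[ℝ] L
  sqrt_symm : ∀ u v : L, inner ℝ (sqrt u) v = inner ℝ u (sqrt v)
  sqrt_nonneg : ∀ u : L, 0 ≤ inner ℝ (sqrt u) u
  sqrt_sqrt : ∀ u : L, sqrt (sqrt u) = op u

namespace Covariance

variable {L : Type*} [NormedAddCommGroup L] [InnerProductSpace ℝ L]

theorem sqrt_injective (Q : Covariance L) : Function.Injective Q.sqrt := by
  refine (injective_iff_map_eq_zero Q.sqrt).2 fun u hu => ?_
  by_contra hne
  have h := Q.posDef u hne
  rw [← Q.sqrt_sqrt, hu, map_zero, inner_zero_left] at h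
  exact lt_irrefl _ h

/-- The space `U₀ = Q^{1/2}(L)`. -/
def U0 (Q : Covariance L) : Type _ := LinearMap.range (Q.sqrt : L →ₗ[ℝ] L)

instance (Q : Covariance L) : AddCommGroup Q.U0 :=
  inferInstanceAs (AddCommGroup (LinearMap.range (Q.sqrt : L →ₗ[ℝ] L)))

instance (Q : Covariance L) : Module ℝ Q.U0 :=
  inferInstanceAs (Module ℝ (LinearMap.range (Q.sqrt : L →ₗ[ℝ] L)))

/-- The inclusion `U₀ ⊆ L`. -/
def incl (Q : Covariance L) : Q.U0 →ₗ[ℝ] L :=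
  (LinearMap.range (Q.sqrt : L →ₗ[ℝ] L)).subtype

/-- `Q^{1/2}` as a linear bijection of `L` onto `U₀`. -/
def sqrtEquiv (Q : Covariance L) : L ≃ₗ[ℝ] Q.U0 :=
  LinearEquiv.ofInjective (Q.sqrt : L →ₗ[ℝ] L) Q.sqrt_injective

theorem incl_sqrtEquiv (Q : Covariance L) (v : L) : Q.incl (Q.sqrtEquiv v) = Q.sqrt v := rfl

/-- `U₀` carries the norm `‖w‖ = ‖Q^{-1/2} w‖`. -/
instance (Q : Covariance L) : NormedAddCommGroup Q.U0 :=
  NormedAddCommGroup.induced Q.U0 L Q.sqrtEquiv.symm Q.sqrtEquiv.symm.injective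

/-- `U₀` carries the inner product `⟨v, w⟩ = ⟨Q^{-1/2} v, Q^{-1/2} w⟩`. -/
instance (Q : Covariance L) : InnerProductSpace ℝ Q.U0 :=
  InnerProductSpace.induced (𝕜 := ℝ) Q.sqrtEquiv.symm

/-- `Q^{1/2}` as a linear isometry of `L` onto `U₀`. -/
def sqrtIso (Q : Covariance L) : L ≃ₗᵢ[ℝ] Q.U0 where
  toLinearEquiv := Q.sqrtEquiv
  norm_map' v := congrArg norm (Q.sqrtEquiv.symm_apply_apply v)

/-- The orthonormal basis `(Q^{1/2} eⱼ)` of `U₀` given by an orthonormal basis `(eⱼ)` of `L`. -/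
def u0Basis {ι : Type*} (Q : Covariance L) (e : HilbertBasis ι ℝ L) : HilbertBasis ι ℝ Q.U0 :=
  HilbertBasis.ofRepr (Q.sqrtIso.symm.trans e.repr)

end Covariance

/-- The square `∑ⱼ ‖T ηⱼ‖²` of the Hilbert–Schmidt norm of a bounded operator, computed (in
`[0, ∞]`) in an orthonormal basis `(ηⱼ)`. -/
def hsNormSq {ι U V : Type*} [NormedAddCommGroup U] [InnerProductSpace ℝ U]
    [NormedAddCommGroup V] [InnerProductSpace ℝ V] (η : HilbertBasis ι ℝ U) (T : U →L[ℝ] V) : ℝ≥0∞ :=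
  ∑' j, ‖T (η j)‖ₑ ^ 2

/-- The Hilbert–Schmidt norm of a Hilbert–Schmidt operator. -/
def hsNorm {ι U V : Type*} [NormedAddCommGroup U] [InnerProductSpace ℝ U]
    [NormedAddCommGroup V] [InnerProductSpace ℝ V] (η : HilbertBasis ι ℝ U) (T : U →L[ℝ] V) : ℝ :=
  Real.sqrt (hsNormSq η T).toReal

/-- `(B(h)v)(x) = (-Jer(x, h₁(x), h₂(x)) v(x), -Jmr(x, h₁(x), h₂(x)) v(x))` for `v ∈ U₀`. -/
def IsDiffusionNemytskij {Θ : Set E3} {Q : Covariance (ScalarL2 Θ)} (Jer Jmr : E3 → E3 → E3 → E3)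
    (B : Fields Θ → (Q.U0 →L[ℝ] Fields Θ)) : Prop :=
  ∀ (h : Fields Θ) (v : Q.U0), ∀ᵐ x ∂(volume.restrict Θ),
    (B h v).fst x = -(Q.incl v x • Jer x (h.fst x) (h.snd x)) ∧
    (B h v).snd x = -(Q.incl v x • Jmr x (h.fst x) (h.snd x))

/-! ## The Wiener process and the scheme -/

/-- A `Q`-Wiener process `W(t) = ∑ⱼ βⱼ(t) Q^{1/2} eⱼ` with respect to the filtration `ℱ`, given by
an orthonormal basis `(eⱼ)` and independent real Brownian motions `(βⱼ)` which are adapted to `ℱ`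
and whose increments after time `s` are jointly independent of `ℱ s`. -/
structure QWiener {Ω : Type*} {mΩ : MeasurableSpace Ω} (P : Measure Ω) (ℱ : Filtration ℝ≥0 mΩ)
    (L : Type*) [NormedAddCommGroup L] [InnerProductSpace ℝ L] where
  e : HilbertBasis ℕ ℝ L
  β : ℕ → ℝ≥0 → Ω → ℝ
  brownian : ∀ j, IsBrownianReal (β j) P
  indep : iIndepFun (fun j ω t => β j t ω) P
  adapted : ∀ j t, Measurable[ℱ t] (β j t)
  indep_past : ∀ s t : ℝ≥0, s ≤ t →
    Indep (MeasurableSpace.comap (fun ω (j : ℕ) => β j t ω - β j s ω) MeasurableSpace.pi) (ℱ s) P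

/-- `N = Φ (W(t) - W(s))` almost surely, for a random operator `Φ : Ω → (U₀ → V)`: the series
`∑ⱼ (βⱼ(t) - βⱼ(s)) Φ(Q^{1/2} eⱼ)` converges to `N` in probability. -/
def IsNoiseTerm {Ω : Type*} {mΩ : MeasurableSpace Ω} {P : Measure Ω} {ℱ : Filtration ℝ≥0 mΩ}
    {L V : Type*} [NormedAddCommGroup L] [InnerProductSpace ℝ L]
    [NormedAddCommGroup V] [InnerProductSpace ℝ V]
    (Q : Covariance L) (W : QWiener P ℱ L) (s t : ℝ≥0) (Φ : Ω → (Q.U0 →L[ℝ] V)) (N : Ω → V) : Prop :=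
  TendstoInMeasure P
    (fun n ω => ∑ j ∈ Finset.range n, (W.β j t ω - W.β j s ω) • Φ ω (Q.u0Basis W.e j)) atTop N

/-- `(u_k)` is a solution, adapted to `(ℱ_{t_k})` with `t_k = k Δt`, of the semi-implicit Euler scheme
`u_{k+1} - u_k = Δt M u_{k+1} - σ₀ Δt u_{k+1} + Δt F(u_{k+1}) + B(u_k) ΔW_k`
with initial value `u₀`. In particular `u_{k+1} ∈ D(M)` almost surely. -/
structure IsSchemeSolution {Ω : Type*} {mΩ : MeasurableSpace Ω} {P : Measure Ω}
    {ℱ : Filtration ℝ≥0 mΩ} {Θ : Set E3} (Q : Covariance (ScalarL2 Θ))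
    (W : QWiener P ℱ (ScalarL2 Θ)) (σ₀ : ℝ) (F : Fields Θ → Fields Θ)
    (B : Fields Θ → (Q.U0 →L[ℝ] Fields Θ)) (u₀ : Ω → Fields Θ) (Δt : ℝ≥0)
    (u : ℕ → Ω → Fields Θ) : Prop where
  adapted : ∀ k : ℕ, StronglyMeasurable[ℱ (k * Δt)] (u k)
  initial : u 0 =ᵐ[P] u₀
  step : ∀ k : ℕ, ∃ N : Ω → Fields Θ,
    IsNoiseTerm Q W (k * Δt) ((k + 1) * Δt) (fun ω => B (u k ω)) N ∧
    ∀ᵐ ω ∂P, ∃ w : Fields Θ, IsMaxwell (u (k + 1) ω) w ∧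
      u (k + 1) ω - u k ω =
        (Δt : ℝ) • w - (σ₀ * (Δt : ℝ)) • u (k + 1) ω + (Δt : ℝ) • F (u (k + 1) ω) + N ω

/-! ## The constants -/

/-- `R_p = (p(p-1)/2 · (p/(p-1))^{p-2})^{1/2}`, used for integers `p ≥ 2` only. -/
def R (p : ℕ) : ℝ :=
  Real.sqrt ((p : ℝ) * ((p : ℝ) - 1) / 2 * ((p : ℝ) / ((p : ℝ) - 1)) ^ (p - 2))

/-- `R̃_q`, as a function of `q` and `a = α̃_B`. In the range of summation none of the natural number
subtractions truncates. -/
def Rtilde (q : ℕ) (a : ℝ) : ℝ :=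
  (1 + 4 * a * R (2 * q)) ^ q +
    ∑ i₁ ∈ Finset.range q, ∑ i₂ ∈ Finset.range (q - i₁),
      (q.choose i₁ : ℝ) * ((q - i₁).choose i₂ : ℝ) * 2 ^ (3 * q - 3 * i₁ - i₂ - 1) *
        R (2 * q) ^ (2 * q - 2 * i₁ - i₂) * a ^ (2 * q - 2 * i₁ - i₂)

end

end StochMaxwell

/-! Well-posedness. With `h` the step size, one step is the equation `u - h M u + h (σ₀ - F) u = g`,
where `g = u_k + B(u_k) ΔW_k`. Smooth compactly supported fields satisfy the symmetric Green formula
for the curl, and the boundary condition in `H₀(curl)` is defined by duality, so `M` is skew-adjoint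
(`isSkewAdjointRel_isMaxwell`) and drops out of every energy identity. Because `σ₀` exceeds the
one-sided Lipschitz constant of `F`, the map `σ₀ - F` is monotone. It is hemicontinuous although no
growth is assumed: an everywhere defined monotone map is locally bounded, and boundedness in `L²`
together with almost everywhere convergence (from the Carathéodory condition) gives weak
convergence. Hence the sum with `-h M` is maximal monotone (`IsSkewAdjointRel.maximal_add`) and
Minty's theorem solves the equation. The solution map is nonexpansive in `g`, which yields
uniqueness and, by continuity, adaptedness.

Noise. Given the past, the increments form a Gaussian sequence independent of the coefficients
`B(u_k) Q^{1/2} eⱼ`. After division by `1 + ‖u_k‖` the coefficients are square summable in mean, so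
the series converges in probability without any moment assumption on `u_k` (`exists_noise`).

Moments. Testing the step with `u` gives `(1 + 2(σ₀ - α̃_F) h) ‖u‖² ≤ ‖g‖² + 2 α̃_F h`. Raised to
the power `q`, the left factor is at least `1 + 2q(σ₀ - α̃_F) h` by Bernoulli. On the right, a
second-order expansion, in which the linear noise term has mean zero and the quadratic one has size
`h`, gives growth by at most `1 + c h` plus an error `K h`, with `c = 1 + 2q(2q-1) α̃_B²`
(`exists_lintegral_norm_add_pow_le`). Since `R̃_q ≥ 1 + 4q(2q-1) α̃_B²`, the damping rate `2q(σ₀ -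
α̃_F)` exceeds `c + 1`; therefore `E‖u₀‖^{2q} + K` bounds every later moment. -/

namespace StochMaxwell

/-! ## Maximal monotone relations -/

section Monotone

variable {H : Type*} [NormedAddCommGroup H] [InnerProductSpace ℝ H]

/-- A skew-adjoint linear relation, i.e. a relation whose adjoint is its negative. -/
def IsSkewAdjointRel (Γ : H → H → Prop) : Prop :=
  ∀ u w, Γ u w ↔ ∀ v w', Γ v w' → inner ℝ u w' + inner ℝ w v = 0

namespace IsSkewAdjointRel

variable {Γ : H → H → Prop}

theorem zero (hΓ : IsSkewAdjointRel Γ) : Γ 0 0 := (hΓ 0 0).2 fun v w' _ => by simp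

theorem add (hΓ : IsSkewAdjointRel Γ) {u w u' w' : H} (h : Γ u w) (h' : Γ u' w') :
    Γ (u + u') (w + w') := by
  refine (hΓ _ _).2 fun a b hab => ?_
  have h1 := (hΓ _ _).1 h a b hab
  have h2 := (hΓ _ _).1 h' a b hab
  rw [inner_add_left, inner_add_left]
  linarith

theorem smul (hΓ : IsSkewAdjointRel Γ) (c : ℝ) {u w : H} (h : Γ u w) : Γ (c • u) (c • w) := by
  refine (hΓ _ _).2 fun a b hab => ?_
  have h1 := (hΓ _ _).1 h a b hab
  rw [real_inner_smul_left, real_inner_smul_left, ← mul_add, h1, mul_zero]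

theorem sub (hΓ : IsSkewAdjointRel Γ) {u w u' w' : H} (h : Γ u w) (h' : Γ u' w') :
    Γ (u - u') (w - w') := by
  simpa [sub_eq_add_neg] using hΓ.add h (hΓ.smul (-1) h')

/-- The pair is tested against itself. This is conservation of energy, and it removes the Maxwell
term from all later estimates. -/
theorem inner_eq_zero (hΓ : IsSkewAdjointRel Γ) {u w : H} (h : Γ u w) : inner ℝ u w = 0 := by
  have := (hΓ _ _).1 h u w h
  rw [real_inner_comm u w] at this
  linarith [real_inner_comm u w]

/-- The graph of a skew-adjoint relation as a subspace. -/
def graph (hΓ : IsSkewAdjointRel Γ) : Submodule ℝ (H × H) where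
  carrier := {z | Γ z.1 z.2}
  add_mem' h h' := hΓ.add h h'
  zero_mem' := hΓ.zero
  smul_mem' c _ h := hΓ.smul c h

end IsSkewAdjointRel

variable [CompleteSpace H]

/-- `E` plays the part of the epigraph of a closed convex function. The added square makes the
functional uniformly convex in the first variable, so minimising sequences are Cauchy there; no
compactness is needed. -/
theorem exists_isMinOn_add_half_norm_sq {E : Set (H × ℝ)} (hne : E.Nonempty) (hcl : IsClosed E)
    (hconv : Convex ℝ E) (hnn : ∀ z ∈ E, 0 ≤ z.2 + 1 / 2 * ‖z.1‖ ^ 2) :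
    ∃ z₀ ∈ E, ∀ z ∈ E, z₀.2 + 1 / 2 * ‖z₀.1‖ ^ 2 ≤ z.2 + 1 / 2 * ‖z.1‖ ^ 2 := by
  set f : H × ℝ → ℝ := fun z => z.2 + 1 / 2 * ‖z.1‖ ^ 2 with hf
  have hfc : Continuous f := by fun_prop
  have hbdd : BddBelow (f '' E) := ⟨0, by rintro _ ⟨z, hz, rfl⟩; exact hnn z hz⟩
  set m := sInf (f '' E) with hm
  have hmle : ∀ z ∈ E, m ≤ f z := fun z hz => csInf_le hbdd ⟨z, hz, rfl⟩
  have hex : ∀ n : ℕ, ∃ z ∈ E, f z < m + 1 / ((n : ℝ) + 1) := by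
    intro n
    have hlt : m < m + 1 / ((n : ℝ) + 1) := by
      have : (0 : ℝ) < 1 / ((n : ℝ) + 1) := by positivity
      linarith
    obtain ⟨_, ⟨z, hz, rfl⟩, h⟩ := exists_lt_of_csInf_lt (hne.image f) hlt
    exact ⟨z, hz, h⟩
  choose z hzE hz using hex
  -- The midpoint lies in `E`, so its value is at least `m`; by the parallelogram law it is the mean
  -- of the two values minus an eighth of the squared distance.
  have hmid : ∀ i j, ‖(z i).1 - (z j).1‖ ^ 2 ≤
      4 * (1 / ((i : ℝ) + 1) + 1 / ((j : ℝ) + 1)) := by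
    intro i j
    have h1 : (1 / 2 : ℝ) • z i + (1 / 2 : ℝ) • z j ∈ E :=
      hconv (hzE i) (hzE j) (by norm_num) (by norm_num) (by norm_num)
    have h2 := hmle _ h1
    have h3 : ‖(1 / 2 : ℝ) • (z i).1 + (1 / 2 : ℝ) • (z j).1‖ ^ 2 =
        1 / 4 * (2 * ‖(z i).1‖ ^ 2 + 2 * ‖(z j).1‖ ^ 2 - ‖(z i).1 - (z j).1‖ ^ 2) := by
      have hp := parallelogram_law_with_norm ℝ (z i).1 (z j).1
      rw [← smul_add, norm_smul, mul_pow]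
      norm_num
      nlinarith
    have h4 := hz i
    have h5 := hz j
    simp only [hf, Prod.snd_add, Prod.fst_add, Prod.smul_fst, Prod.smul_snd, h3,
      smul_eq_mul] at h2 h4 h5
    linarith
  have hlim : Tendsto (fun n : ℕ => 1 / ((n : ℝ) + 1)) atTop (𝓝 0) :=
    tendsto_one_div_add_atTop_nhds_zero_nat
  have hcau : CauchySeq fun n => (z n).1 := by
    refine Metric.cauchySeq_iff'.2 fun ε hε => ?_
    have hε2 : 0 < ε ^ 2 / 8 := by positivity
    obtain ⟨N, hN⟩ := (hlim.eventually (gt_mem_nhds hε2)).exists_forall_of_atTop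
    refine ⟨N, fun n hn => ?_⟩
    have h1 := hmid n N
    have h2 := hN n hn
    have h3 := hN N le_rfl
    rw [dist_eq_norm]
    refine lt_of_pow_lt_pow_left₀ 2 hε.le ?_
    linarith
  obtain ⟨x, hx⟩ := cauchySeq_tendsto_of_complete hcau
  have hfz : Tendsto (fun n => f (z n)) atTop (𝓝 m) := by
    refine tendsto_of_tendsto_of_tendsto_of_le_of_le tendsto_const_nhds
      (h := fun n : ℕ => m + 1 / ((n : ℝ) + 1)) ?_ (fun n => hmle _ (hzE n)) (fun n => (hz n).le)
    simpa using hlim.const_add m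
  have ht : Tendsto (fun n => (z n).2) atTop (𝓝 (m - 1 / 2 * ‖x‖ ^ 2)) := by
    refine (hfz.sub ((hx.norm.pow 2).const_mul (1 / 2))).congr fun n => ?_
    simp [hf]
  refine ⟨(x, m - 1 / 2 * ‖x‖ ^ 2), hcl.mem_of_tendsto (hx.prodMk_nhds ht)
    (Eventually.of_forall hzE), fun w hw => ?_⟩
  have := hmle w hw
  simp only [hf] at this
  linarith

theorem nonneg_of_forall_nonneg_add_mul {a b : ℝ} (h : ∀ s : ℝ, 0 < s → s ≤ 1 → 0 ≤ a + s * b) :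
    0 ≤ a := by
  have hlim : Tendsto (fun n : ℕ => a + 1 / ((n : ℝ) + 1) * b) atTop (𝓝 (a + 0 * b)) :=
    (tendsto_one_div_add_atTop_nhds_zero_nat.mul_const b).const_add a
  rw [zero_mul, add_zero] at hlim
  refine ge_of_tendsto' hlim fun n => h _ (by positivity) ?_
  rw [div_le_one (by positivity)]
  linarith [(Nat.cast_nonneg n : (0 : ℝ) ≤ n)]

/-- First-order condition at the minimiser: move from `z₀` towards `z` by a fraction `s`, divide by
`s` and let `s` tend to zero. -/
theorem exists_neg_mem_subgradient {E : Set (H × ℝ)} (hne : E.Nonempty) (hcl : IsClosed E)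
    (hconv : Convex ℝ E) (hnn : ∀ z ∈ E, 0 ≤ z.2 + 1 / 2 * ‖z.1‖ ^ 2) :
    ∃ z₀ ∈ E, ∀ z ∈ E, z₀.2 + ‖z₀.1‖ ^ 2 ≤ z.2 + inner ℝ z₀.1 z.1 := by
  obtain ⟨z₀, hz₀, hmin⟩ := exists_isMinOn_add_half_norm_sq hne hcl hconv hnn
  refine ⟨z₀, hz₀, fun z hz => ?_⟩
  have key : 0 ≤ z.2 - z₀.2 + inner ℝ z₀.1 (z.1 - z₀.1) := by
    refine nonneg_of_forall_nonneg_add_mul (b := 1 / 2 * ‖z.1 - z₀.1‖ ^ 2) fun s hs hs1 => ?_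
    have h1 : (1 - s) • z₀ + s • z ∈ E := hconv hz₀ hz (by linarith) hs.le (by ring)
    have h2 := hmin _ h1
    have h3 : ((1 - s) • z₀ + s • z).1 = z₀.1 + s • (z.1 - z₀.1) := by
      simp only [Prod.fst_add, Prod.smul_fst]
      module
    rw [h3, norm_add_sq_real, real_inner_smul_right, norm_smul, mul_pow, Real.norm_eq_abs,
      sq_abs] at h2
    simp only [Prod.snd_add, Prod.smul_snd, smul_eq_mul] at h2
    have h4 : 0 ≤ s * (z.2 - z₀.2 + inner ℝ z₀.1 (z.1 - z₀.1) +
        s * (1 / 2 * ‖z.1 - z₀.1‖ ^ 2)) := by linarith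
    exact nonneg_of_mul_nonneg_right h4 hs
  rw [inner_sub_right, real_inner_self_eq_norm_sq] at key
  linarith

/-- **Minty's theorem**: if `A` is a maximal monotone relation, then `0 ∈ (I + A) x` for some `x`. -/
theorem exists_self_neg_of_maximal_monotone {A : H → H → Prop}
    (hmono : ∀ a b a' b', A a b → A a' b' → 0 ≤ inner ℝ (a - a') (b - b'))
    (hmax : ∀ u w, (∀ a b, A a b → 0 ≤ inner ℝ (a - u) (b - w)) → A u w) :
    ∃ x, A x (-x) := by
  obtain ⟨a₀, b₀, hab₀⟩ : ∃ a b, A a b := by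
    by_contra! hcon
    exact hcon 0 0 (hmax 0 0 fun a b hab => absurd hab (hcon a b))
  -- Epigraph of the Fitzpatrick function of `A`, the supremum of `⟨x, b⟩ + ⟨a, y⟩ - ⟨a, b⟩` over
  -- the graph. Monotonicity makes it equal to `⟨a, b⟩` on the graph; maximality makes it at least
  -- `⟨x, y⟩` everywhere.
  set E : Set (WithLp 2 (H × H) × ℝ) :=
    {z | ∀ a b, A a b → inner ℝ z.1.fst b + inner ℝ a z.1.snd - inner ℝ a b ≤ z.2} with hE
  have hEA : ∀ a b, A a b → ((WithLp.toLp 2 (a, b), inner ℝ a b) : WithLp 2 (H × H) × ℝ) ∈ E := by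
    intro a b hab a' b' hab'
    have := hmono _ _ _ _ hab hab'
    simp only [inner_sub_left, inner_sub_right] at this
    simp only [WithLp.toLp_fst, WithLp.toLp_snd]
    linarith
  have hEge : ∀ z ∈ E, inner ℝ z.1.fst z.1.snd ≤ z.2 := by
    intro z hz
    by_cases hA : A z.1.fst z.1.snd
    · have := hz _ _ hA
      linarith
    · obtain ⟨a, b, hab, hlt⟩ : ∃ a b, A a b ∧ inner ℝ (a - z.1.fst) (b - z.1.snd) < 0 := by
        by_contra! hcon
        exact hA (hmax _ _ hcon)
      have := hz a b hab
      simp only [inner_sub_left, inner_sub_right] at hlt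
      linarith
  have hcl : IsClosed E := by
    simp only [hE, Set.ofPred_forall]
    refine isClosed_iInter fun a => isClosed_iInter fun b => isClosed_iInter fun _ => ?_
    refine isClosed_le ?_ continuous_snd
    have h1 : Continuous fun z : WithLp 2 (H × H) × ℝ => z.1.fst :=
      (WithLp.prod_continuous_ofLp 2 H H).fst.comp continuous_fst
    have h2 : Continuous fun z : WithLp 2 (H × H) × ℝ => z.1.snd :=
      (WithLp.prod_continuous_ofLp 2 H H).snd.comp continuous_fst
    fun_prop
  have hconv : Convex ℝ E := by
    intro z hz z' hz' s t hs ht hst a b hab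
    have h1 := mul_le_mul_of_nonneg_left (hz a b hab) hs
    have h2 := mul_le_mul_of_nonneg_left (hz' a b hab) ht
    simp only [Prod.fst_add, Prod.smul_fst, Prod.snd_add, Prod.smul_snd, WithLp.add_fst,
      WithLp.add_snd, WithLp.smul_fst, WithLp.smul_snd, inner_add_left, inner_add_right,
      real_inner_smul_left, real_inner_smul_right, smul_eq_mul]
    have h3 : inner ℝ a b = s * inner ℝ a b + t * inner ℝ a b := by rw [← add_mul, hst, one_mul]
    linarith
  have hnn : ∀ z ∈ E, 0 ≤ z.2 + 1 / 2 * ‖z.1‖ ^ 2 := by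
    intro z hz
    have h1 := hEge z hz
    have h2 : 0 ≤ ‖z.1.fst + z.1.snd‖ ^ 2 := sq_nonneg _
    rw [norm_add_sq_real] at h2
    rw [WithLp.prod_norm_sq_eq_of_L2]
    linarith
  obtain ⟨z, hz, hsub⟩ := exists_neg_mem_subgradient ⟨_, hEA _ _ hab₀⟩ hcl hconv hnn
  have hge := hEge z hz
  -- Minimality compared with graph points says that the swapped and negated minimiser is
  -- monotonically related to `A`, with a surplus. Maximality puts it in `A`, and then the surplus
  -- must vanish.
  have key : ∀ a b, A a b →
      ‖z.1.fst + z.1.snd‖ ^ 2 ≤ inner ℝ (a - -z.1.snd) (b - -z.1.fst) := by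
    intro a b hab
    have h1 := hsub _ (hEA _ _ hab)
    rw [WithLp.prod_norm_sq_eq_of_L2, WithLp.prod_inner_apply] at h1
    simp only [sub_neg_eq_add, inner_add_left, inner_add_right, norm_add_sq_real]
    have h2 := real_inner_comm a z.1.fst
    have h3 := real_inner_comm z.1.snd z.1.fst
    simp only [WithLp.ofLp_fst, WithLp.ofLp_snd] at h1
    linarith
  have hA := hmax _ _ fun a b hab => (sq_nonneg _).trans (key a b hab)
  have h0 := key _ _ hA
  simp only [sub_self, inner_zero_left] at h0
  have h1 : z.1.fst + z.1.snd = 0 := by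
    have : ‖z.1.fst + z.1.snd‖ ^ 2 = 0 := le_antisymm h0 (sq_nonneg _)
    simpa using this
  have h2 : - -z.1.snd = -z.1.fst := by
    rw [neg_neg]
    exact (neg_eq_of_add_eq_zero_right h1).symm
  exact ⟨-z.1.snd, h2.symm ▸ hA⟩

/-- An everywhere defined monotone map is locally bounded at `0`. -/
theorem exists_norm_le_of_monotone {G : H → H}
    (hmono : ∀ u v, 0 ≤ inner ℝ (G u - G v) (u - v)) :
    ∃ r C : ℝ, 0 < r ∧ ∀ z, ‖z‖ ≤ r → ‖G z‖ ≤ C := by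
  by_contra! hcon
  have hex : ∀ n : ℕ, ∃ z : H, ‖z‖ ≤ 1 / ((n : ℝ) + 1) ∧ (n : ℝ) < ‖G z‖ := fun n =>
    hcon _ _ (by positivity)
  choose z hz hGz using hex
  -- With this normalisation, monotonicity between `z n` and a fixed `y` bounds `⟨G (z n), y⟩ / α n`
  -- by a quantity depending on `y` only, as uniform boundedness requires.
  set α : ℕ → ℝ := fun n => 1 + ‖G (z n)‖ * ‖z n‖ with hα
  have hαpos : ∀ n, 0 < α n := fun n => by positivity
  have hα1 : ∀ n, 1 ≤ α n := fun n => le_add_of_nonneg_right (by positivity)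
  have hz1 : ∀ n, ‖z n‖ ≤ 1 := fun n => (hz n).trans
    (by rw [div_le_one (by positivity)]; linarith [(Nat.cast_nonneg n : (0 : ℝ) ≤ n)])
  have hub : ∀ y n, inner ℝ (G (z n)) y ≤ α n * (1 + ‖G y‖ * (‖y‖ + 1)) := by
    intro y n
    have h1 := hmono (z n) y
    have h2 : inner ℝ (G (z n)) (z n) ≤ ‖G (z n)‖ * ‖z n‖ := real_inner_le_norm _ _
    have h3 : inner ℝ (G y) (y - z n) ≤ ‖G y‖ * (‖y‖ + 1) :=
      (real_inner_le_norm _ _).trans (mul_le_mul_of_nonneg_left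
        ((norm_sub_le _ _).trans (by linarith [hz1 n])) (norm_nonneg _))
    have h4 : 0 ≤ ‖G y‖ * (‖y‖ + 1) := by positivity
    have h5 : ‖G y‖ * (‖y‖ + 1) ≤ α n * (‖G y‖ * (‖y‖ + 1)) :=
      le_mul_of_one_le_left h4 (hα1 n)
    simp only [inner_sub_left, inner_sub_right] at h1 h3
    have h6 : α n = 1 + ‖G (z n)‖ * ‖z n‖ := rfl
    nlinarith
  obtain ⟨C, hC⟩ := banach_steinhaus
    (g := fun n => innerSL ℝ ((α n)⁻¹ • G (z n))) (fun y => by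
    refine ⟨max (1 + ‖G y‖ * (‖y‖ + 1)) (1 + ‖G (-y)‖ * (‖y‖ + 1)), fun n => ?_⟩
    have h1 := hub y n
    have h2 := hub (-y) n
    rw [inner_neg_right, norm_neg] at h2
    rw [innerSL_apply_apply, real_inner_smul_left, Real.norm_eq_abs, abs_le]
    have hi := hαpos n
    constructor
    · refine (neg_le_neg (le_max_right _ _)).trans ?_
      rw [neg_le, ← mul_neg, inv_mul_le_iff₀ hi]
      exact h2
    · refine le_trans ?_ (le_max_left _ _)
      rwa [inv_mul_le_iff₀ hi])
  -- For such `n` the bound `‖G (z n)‖ ≤ C α n` can be absorbed, because `C ‖z n‖ ≤ 1/2`; it leaves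
  -- `‖G (z n)‖ ≤ 2 C < n`, a contradiction.
  obtain ⟨n, hn⟩ := exists_nat_gt (2 * C + 2 * |C|)
  have h1 := hC n
  simp only [innerSL_apply_norm, norm_smul, norm_inv, Real.norm_eq_abs, abs_of_pos (hαpos n)] at h1
  rw [inv_mul_le_iff₀ (hαpos n)] at h1
  have h2 := hGz n
  have hn0 : (0 : ℝ) < (n : ℝ) + 1 := by positivity
  have hC0 : 0 ≤ C := (norm_nonneg _).trans (hC 0)
  have h3 : ‖z n‖ * C ≤ 1 / 2 := by
    have : ‖z n‖ * C ≤ 1 / ((n : ℝ) + 1) * C := mul_le_mul_of_nonneg_right (hz n) hC0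
    refine this.trans ?_
    rw [div_mul_eq_mul_div, div_le_div_iff₀ hn0 two_pos]
    linarith [le_abs_self C]
  have h4 : ‖G (z n)‖ ≤ C + ‖G (z n)‖ * (‖z n‖ * C) := by
    calc ‖G (z n)‖ ≤ (1 + ‖G (z n)‖ * ‖z n‖) * C := h1
      _ = _ := by ring
  nlinarith [norm_nonneg (G (z n)), le_abs_self C]

namespace IsSkewAdjointRel

variable {Γ : H → H → Prop}

/-- The bound says that `z ↦ ⟨u, m⟩` is a well-defined continuous functional on the domain of `Γ`.
Hahn–Banach and Riesz represent it by a vector, whose negative is a value of `Γ` at `u` since `Γ` is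
minus its adjoint. -/
theorem exists_of_bounded (hΓ : IsSkewAdjointRel Γ) {u : H} {C : ℝ}
    (hC : ∀ z m, Γ z m → |inner ℝ u m| ≤ C * ‖z‖) : ∃ y, Γ u y := by
  set π : hΓ.graph →ₗ[ℝ] H := (LinearMap.fst ℝ H H).comp hΓ.graph.subtype with hπ
  -- A linear choice of a value over each point of the domain. The choice is immaterial: two values
  -- over one point differ by a value over `0`, on which the bound vanishes.
  obtain ⟨σ, hσ⟩ := π.rangeRestrict.exists_rightInverse_of_surjective π.range_rangeRestrict
  have hσ' : ∀ z : LinearMap.range π, ((σ z : H × H)).1 = z := fun z =>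
    congrArg Subtype.val (LinearMap.congr_fun hσ z)
  have hσm : ∀ z : LinearMap.range π, Γ z ((σ z : H × H)).2 := fun z => by
    have : Γ (σ z : H × H).1 (σ z : H × H).2 := (σ z).2
    rwa [hσ'] at this
  set f : LinearMap.range π →ₗ[ℝ] ℝ :=
    (innerSL ℝ u : H →ₗ[ℝ] ℝ).comp (((LinearMap.snd ℝ H H).comp hΓ.graph.subtype).comp σ) with hf
  set f' : StrongDual ℝ (LinearMap.range π) := f.mkContinuous C (fun z => hC _ _ (hσm z)) with hf'
  obtain ⟨g, hg, -⟩ := exists_extension_norm_eq (LinearMap.range π) f'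
  refine ⟨-(InnerProductSpace.toDual ℝ H).symm g, (hΓ _ _).2 fun v w' hv => ?_⟩
  have hvr : v ∈ LinearMap.range π := ⟨⟨(v, w'), hv⟩, rfl⟩
  have h1 : g v = inner ℝ u (σ ⟨v, hvr⟩ : H × H).2 := hg ⟨v, hvr⟩
  have h2 : |inner ℝ u (w' - (σ ⟨v, hvr⟩ : H × H).2)| ≤ C * ‖v - v‖ :=
    hC _ _ (hΓ.sub hv (hσm ⟨v, hvr⟩))
  rw [sub_self, norm_zero, mul_zero, abs_nonpos_iff, inner_sub_right] at h2
  rw [inner_neg_left, InnerProductSpace.toDual_symm_apply, h1]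
  linarith

/-- The sum of a skew-adjoint relation and an everywhere defined, monotone and hemicontinuous map
is maximal monotone. -/
theorem maximal_add (hΓ : IsSkewAdjointRel Γ) {G : H → H}
    (hmono : ∀ u v, 0 ≤ inner ℝ (G u - G v) (u - v))
    (hhemi : ∀ u z, Tendsto (fun n : ℕ => inner ℝ z (G (u - (1 / ((n : ℝ) + 1)) • z))) atTop
      (𝓝 (inner ℝ z (G u))))
    {u w : H} (h : ∀ v m, Γ v m → 0 ≤ inner ℝ (v - u) (G v + m - w)) :
    ∃ m, Γ u m ∧ w = G u + m := by
  obtain ⟨r, C, hr, hC⟩ := exists_norm_le_of_monotone hmono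
  have hC0 : 0 ≤ C := (norm_nonneg _).trans (hC 0 (by simpa using hr.le))
  set K : ℝ := (r + ‖u‖) * (C + ‖w‖) / r with hK
  have hK0 : 0 ≤ K := by positivity
  -- The hypothesis is tested at `r • z`, inside the ball where `G` is bounded. As `⟨z, m⟩ = 0`, the
  -- only unbounded term left is the one linear in `m`, so `u` lies in the domain of the adjoint.
  have hup : ∀ z m, Γ z m → ‖z‖ ≤ 1 → inner ℝ u m ≤ K := by
    intro z m hzm hz
    have h1 := h _ _ (hΓ.smul r hzm)
    have hrz : ‖r • z‖ ≤ r := by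
      rw [norm_smul, Real.norm_eq_abs, abs_of_pos hr]
      exact mul_le_of_le_one_right hr.le hz
    have h2 : inner ℝ (r • z - u) (r • m) = -(r * inner ℝ u m) := by
      rw [inner_sub_left, real_inner_smul_left, real_inner_smul_right, real_inner_smul_right,
        hΓ.inner_eq_zero hzm]
      ring
    have h3 : inner ℝ (r • z - u) (G (r • z) - w) ≤ (r + ‖u‖) * (C + ‖w‖) := by
      refine (real_inner_le_norm _ _).trans (mul_le_mul ?_ ?_ (norm_nonneg _) (by positivity))
      · exact (norm_sub_le _ _).trans (by linarith)
      · exact (norm_sub_le _ _).trans (by linarith [hC _ hrz])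
    have h4 : G (r • z) + r • m - w = (G (r • z) - w) + r • m := by abel
    rw [h4, inner_add_right, h2] at h1
    rw [hK, le_div_iff₀ hr]
    linarith
  have hbd : ∀ z m, Γ z m → ‖z‖ ≤ 1 → |inner ℝ u m| ≤ K := by
    intro z m hzm hz
    refine abs_le.2 ⟨?_, hup z m hzm hz⟩
    have := hup _ _ (hΓ.smul (-1) hzm) (by simpa using hz)
    rw [real_inner_smul_right] at this
    linarith
  obtain ⟨y, hy⟩ : ∃ y, Γ u y := by
    refine hΓ.exists_of_bounded (C := K) fun z m hzm => ?_
    rcases eq_or_ne z 0 with rfl | hz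
    · rw [norm_zero, mul_zero, abs_nonpos_iff]
      by_contra hne
      obtain ⟨n, hn⟩ := exists_nat_gt (K / |inner ℝ u m|)
      have h1 := hbd _ _ (hΓ.smul n hzm) (by simp)
      rw [real_inner_smul_right, abs_mul, Nat.abs_cast] at h1
      rw [div_lt_iff₀ (abs_pos.2 hne)] at hn
      linarith
    · have hz' : 0 < ‖z‖ := norm_pos_iff.2 hz
      have h1 := hbd _ _ (hΓ.smul ‖z‖⁻¹ hzm) (by
        rw [norm_smul, norm_inv, norm_norm, inv_mul_cancel₀ hz'.ne'])
      rw [real_inner_smul_right, abs_mul, abs_inv, abs_norm, inv_mul_le_iff₀ hz'] at h1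
      linarith
  -- Minty's trick: test at `u - s z`, divide by `s` and let `s` tend to zero, using hemicontinuity.
  -- Replacing `z` by `-z` then makes `w - y - G u` orthogonal to the domain, that is, a value of
  -- `Γ` at `0`.
  have hge : ∀ z m, Γ z m → 0 ≤ inner ℝ z (w - y - G u) := by
    intro z m hzm
    have hlim : Tendsto (fun n : ℕ => inner ℝ z (w - y) + 1 / ((n : ℝ) + 1) * inner ℝ z m
        - inner ℝ z (G (u - (1 / ((n : ℝ) + 1)) • z))) atTop
        (𝓝 (inner ℝ z (w - y) + 0 * inner ℝ z m - inner ℝ z (G u))) :=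
      ((tendsto_one_div_add_atTop_nhds_zero_nat.mul_const _).const_add _).sub (hhemi u z)
    rw [zero_mul, add_zero, ← inner_sub_right] at hlim
    refine ge_of_tendsto' hlim fun n => ?_
    set s : ℝ := 1 / ((n : ℝ) + 1) with hs
    have hspos : 0 < s := by positivity
    have h1 := h _ _ (hΓ.sub hy (hΓ.smul s hzm))
    have h2 : u - s • z - u = (-s) • z := by module
    have h3 : G (u - s • z) + (y - s • m) - w = G (u - s • z) - (w - y) - s • m := by abel
    rw [h2, h3, real_inner_smul_left, inner_sub_right, inner_sub_right z (G _),
      real_inner_smul_right] at h1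
    have h4 : 0 ≤ s * (inner ℝ z (w - y) + s * inner ℝ z m - inner ℝ z (G (u - s • z))) := by
      linarith
    exact nonneg_of_mul_nonneg_right h4 hspos
  have hzero : Γ 0 (w - y - G u) := by
    refine (hΓ _ _).2 fun v w' hv => ?_
    have h1 := hge _ _ hv
    have h2 := hge _ _ (hΓ.smul (-1) hv)
    rw [real_inner_smul_left] at h2
    rw [inner_zero_left, zero_add, real_inner_comm]
    linarith
  refine ⟨y + (w - y - G u), ?_, by abel⟩
  simpa using hΓ.add hy hzero

/-- Solvability of `u + G u + m = g` with `(u, m)` in a skew-adjoint relation. -/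
theorem exists_solution (hΓ : IsSkewAdjointRel Γ) {G : H → H}
    (hmono : ∀ u v, 0 ≤ inner ℝ (G u - G v) (u - v))
    (hhemi : ∀ u z, Tendsto (fun n : ℕ => inner ℝ z (G (u - (1 / ((n : ℝ) + 1)) • z))) atTop
      (𝓝 (inner ℝ z (G u)))) (g : H) :
    ∃ u m, Γ u m ∧ u + G u + m = g := by
  -- Minty's theorem is applied to `G + Γ - g`; the skew part contributes nothing to monotonicity.
  have h1 : ∀ a b a' b', (∃ m, Γ a m ∧ b = G a + m - g) → (∃ m, Γ a' m ∧ b' = G a' + m - g) →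
      0 ≤ inner ℝ (a - a') (b - b') := by
    rintro a _ a' _ ⟨m, hm, rfl⟩ ⟨m', hm', rfl⟩
    have h1 : G a + m - g - (G a' + m' - g) = (G a - G a') + (m - m') := by abel
    rw [h1, inner_add_right, hΓ.inner_eq_zero (hΓ.sub hm hm'), add_zero, real_inner_comm]
    exact hmono a a'
  have h2 : ∀ u w, (∀ a b, (∃ m, Γ a m ∧ b = G a + m - g) → 0 ≤ inner ℝ (a - u) (b - w)) →
      ∃ m, Γ u m ∧ w = G u + m - g := by
    intro u w h
    obtain ⟨m, hm, hw⟩ := hΓ.maximal_add hmono hhemi (u := u) (w := w + g) fun v m hv => by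
      have := h _ _ ⟨m, hv, rfl⟩
      rwa [sub_sub, add_comm g w] at this
    exact ⟨m, hm, by rw [← hw]; abel⟩
  obtain ⟨u, m, hm, h⟩ := exists_self_neg_of_maximal_monotone h1 h2
  refine ⟨u, m, hm, ?_⟩
  have h3 : g = G u + m - -u := by rw [h]; abel
  rw [h3]
  abel

end IsSkewAdjointRel

end Monotone

/-! ## The Maxwell operator is skew-adjoint -/

section Maxwell

theorem partialDeriv_eq_fderiv {φ : E3 → E3} (hφ : ContDiff ℝ (⊤ : ℕ∞) φ) (i j : Fin 3) (x : E3) :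
    partialDeriv φ i j x = fderiv ℝ (fun y => φ y j) x (EuclideanSpace.single i 1) := by
  have h1 : HasFDerivAt φ (fderiv ℝ φ x) x :=
    (hφ.differentiable (by simp)).differentiableAt.hasFDerivAt
  have h2 := (EuclideanSpace.proj j : E3 →L[ℝ] ℝ).hasFDerivAt.comp x h1
  have h3 : fderiv ℝ (fun y => φ y j) x = _ := h2.fderiv
  rw [h3]
  rfl

theorem continuous_partialDeriv {φ : E3 → E3} (hφ : ContDiff ℝ (⊤ : ℕ∞) φ) (i j : Fin 3) :
    Continuous (partialDeriv φ i j) := by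
  have h1 : Continuous (fderiv ℝ φ) := hφ.continuous_fderiv (by simp)
  unfold partialDeriv
  fun_prop

theorem partialDeriv_eq_zero {φ : E3 → E3} (i j : Fin 3) {x : E3} (hx : x ∉ tsupport φ) :
    partialDeriv φ i j x = 0 := by
  rw [partialDeriv, image_eq_zero_of_notMem_tsupport fun h => hx (tsupport_fderiv_subset ℝ h)]
  rfl

theorem curl_eq_zero {φ : E3 → E3} {x : E3} (hx : x ∉ tsupport φ) : curl φ x = 0 := by
  ext i
  fin_cases i <;> simp [curl, partialDeriv_eq_zero _ _ hx]

theorem continuous_curl {φ : E3 → E3} (hφ : ContDiff ℝ (⊤ : ℕ∞) φ) : Continuous (curl φ) := by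
  have h := continuous_partialDeriv hφ
  unfold curl
  refine (PiLp.continuous_toLp 2 _).comp (continuous_pi fun i => ?_)
  fin_cases i
  · exact (h 1 2).sub (h 2 1)
  · exact (h 2 0).sub (h 0 2)
  · exact (h 0 1).sub (h 1 0)

theorem hasCompactSupport_curl {φ : E3 → E3} (hc : HasCompactSupport φ) :
    HasCompactSupport (curl φ) :=
  HasCompactSupport.intro hc fun _ hx => curl_eq_zero hx

theorem integral_mul_partialDeriv {φ ψ : E3 → E3} (hφ : ContDiff ℝ (⊤ : ℕ∞) φ)
    (hφc : HasCompactSupport φ) (hψ : ContDiff ℝ (⊤ : ℕ∞) ψ) (i j k : Fin 3) :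
    Integrable (fun x => φ x i * partialDeriv ψ j k x) ∧
    Integrable (fun x => partialDeriv φ j i x * ψ x k) ∧
    ∫ x, φ x i * partialDeriv ψ j k x = -∫ x, partialDeriv φ j i x * ψ x k := by
  have hφ0 := hφ.continuous
  have hψ0 := hψ.continuous
  have hz : ∀ x, x ∉ tsupport φ → φ x i = 0 := fun x hx => by
    rw [image_eq_zero_of_notMem_tsupport hx]; rfl
  have h1 : Integrable (fun x => φ x i * partialDeriv ψ j k x) := by
    refine Continuous.integrable_of_hasCompactSupport ?_ (.intro hφc fun x hx => ?_)
    · have := continuous_partialDeriv hψ j k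
      fun_prop
    · simp [hz x hx]
  have h2 : Integrable (fun x => partialDeriv φ j i x * ψ x k) := by
    refine Continuous.integrable_of_hasCompactSupport ?_ (.intro hφc fun x hx => ?_)
    · have := continuous_partialDeriv hφ j i
      fun_prop
    · simp [partialDeriv_eq_zero j i hx]
  have h3 : Integrable (fun x => φ x i * ψ x k) := by
    refine Continuous.integrable_of_hasCompactSupport (by fun_prop) (.intro hφc fun x hx => ?_)
    simp [hz x hx]
  refine ⟨h1, h2, ?_⟩
  simp only [partialDeriv_eq_fderiv hφ, partialDeriv_eq_fderiv hψ] at h1 h2 ⊢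
  have hd : ∀ {f : E3 → E3}, ContDiff ℝ (⊤ : ℕ∞) f → ∀ l x, DifferentiableAt ℝ (fun y => f y l) x :=
    fun hf l x => ((EuclideanSpace.proj l : E3 →L[ℝ] ℝ).differentiableAt.comp x (hf.differentiable (by simp)).differentiableAt)
  exact integral_mul_fderiv_eq_neg_fderiv_mul_of_integrable h2 h1 h3
    (fun x _ => hd hφ i x) (fun x _ => hd hψ k x)

/-- Each of the six products changes sign under integration by parts, and the antisymmetry of the
curl changes it back. -/
theorem integral_inner_curl {φ ψ : E3 → E3} (hφ : ContDiff ℝ (⊤ : ℕ∞) φ)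
    (hφc : HasCompactSupport φ) (hψ : ContDiff ℝ (⊤ : ℕ∞) ψ) :
    ∫ x, inner ℝ (φ x) (curl ψ x) = ∫ x, inner ℝ (curl φ x) (ψ x) := by
  have key := fun i j k => integral_mul_partialDeriv hφ hφc hψ i j k
  have h1 : ∀ x, inner ℝ (φ x) (curl ψ x) =
      (φ x 0 * partialDeriv ψ 1 2 x - φ x 0 * partialDeriv ψ 2 1 x) +
      (φ x 1 * partialDeriv ψ 2 0 x - φ x 1 * partialDeriv ψ 0 2 x) +
      (φ x 2 * partialDeriv ψ 0 1 x - φ x 2 * partialDeriv ψ 1 0 x) := fun x => by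
    simp [PiLp.inner_apply, Fin.sum_univ_three, curl]
    ring
  have h2 : ∀ x, inner ℝ (curl φ x) (ψ x) =
      (partialDeriv φ 1 2 x * ψ x 0 - partialDeriv φ 2 1 x * ψ x 0) +
      (partialDeriv φ 2 0 x * ψ x 1 - partialDeriv φ 0 2 x * ψ x 1) +
      (partialDeriv φ 0 1 x * ψ x 2 - partialDeriv φ 1 0 x * ψ x 2) := fun x => by
    simp [PiLp.inner_apply, Fin.sum_univ_three, curl]
    ring
  have hsum : ∀ {f₁ f₂ f₃ f₄ f₅ f₆ : E3 → ℝ}, Integrable f₁ → Integrable f₂ → Integrable f₃ →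
      Integrable f₄ → Integrable f₅ → Integrable f₆ →
      ∫ x, ((f₁ x - f₂ x) + (f₃ x - f₄ x) + (f₅ x - f₆ x)) =
        ((∫ x, f₁ x) - ∫ x, f₂ x) + ((∫ x, f₃ x) - ∫ x, f₄ x) + ((∫ x, f₅ x) - ∫ x, f₆ x) := by
    intro f₁ f₂ f₃ f₄ f₅ f₆ i₁ i₂ i₃ i₄ i₅ i₆
    have i := i₁.sub i₂
    have j := i₃.sub i₄
    have k := i₅.sub i₆
    calc _ = ∫ x, ((f₁ - f₂) + (f₃ - f₄) + (f₅ - f₆)) x := rfl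
      _ = _ := by
        rw [integral_add' (i.add j) k, integral_add' i j, integral_sub' i₁ i₂, integral_sub' i₃ i₄,
          integral_sub' i₅ i₆]
  have a := fun i j k => (key i j k).1
  have b := fun i j k => (key i j k).2.1
  simp only [h1, h2]
  rw [hsum (a 0 1 2) (a 0 2 1) (a 1 2 0) (a 1 0 2) (a 2 0 1) (a 2 1 0),
    hsum (b 2 1 0) (b 1 2 0) (b 0 2 1) (b 2 0 1) (b 1 0 2) (b 0 1 2)]
  simp only [(key _ _ _).2.2]
  ring

variable {Θ : Set E3}

theorem memLp_of_continuous_hasCompactSupport {φ : E3 → E3} (hφ : Continuous φ)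
    (hc : HasCompactSupport φ) : MemLp φ 2 (volume.restrict Θ) :=
  (hφ.memLp_of_hasCompactSupport hc).restrict Θ

theorem integral_inner_congr_left {f g k : E3 → E3} (h : f =ᵐ[volume.restrict Θ] g) :
    ∫ x in Θ, inner ℝ (f x) (k x) = ∫ x in Θ, inner ℝ (g x) (k x) :=
  integral_congr_ae (by filter_upwards [h] with x hx; rw [hx])

/-- The support of `φ` may leave `Θ`; that of the test field may not, so the integrals over `Θ` are
integrals over the whole space. -/
theorem hasWeakCurl_toLp {φ : E3 → E3} (hφ : ContDiff ℝ (⊤ : ℕ∞) φ) (hc : HasCompactSupport φ)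
    (h1 : MemLp φ 2 (volume.restrict Θ)) (h2 : MemLp (curl φ) 2 (volume.restrict Θ)) :
    HasWeakCurl (h1.toLp φ) (h2.toLp (curl φ)) := by
  intro ψ hψ hψc hψΘ
  rw [integral_inner_congr_left h1.coeFn_toLp, integral_inner_congr_left h2.coeFn_toLp,
    setIntegral_eq_integral_of_forall_compl_eq_zero fun x hx => ?_,
    setIntegral_eq_integral_of_forall_compl_eq_zero fun x hx => ?_]
  · exact integral_inner_curl hφ hc hψ
  · rw [image_eq_zero_of_notMem_tsupport fun h => hx (hψΘ h), inner_zero_right]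
  · rw [curl_eq_zero fun h => hx (hψΘ h), inner_zero_right]

/-- Weak curls become identities between inner products in `L²`, the form in which adjoints can be
compared. -/
theorem hasWeakCurl_iff {v w : VecL2 Θ} : HasWeakCurl v w ↔
    ∀ (φ : E3 → E3) (h1 : MemLp φ 2 (volume.restrict Θ))
      (h2 : MemLp (curl φ) 2 (volume.restrict Θ)), ContDiff ℝ (⊤ : ℕ∞) φ → HasCompactSupport φ →
      tsupport φ ⊆ Θ → inner ℝ v (h2.toLp (curl φ)) = inner ℝ w (h1.toLp φ) := by
  have key : ∀ (v : VecL2 Θ) {f : E3 → E3} (hf : MemLp f 2 (volume.restrict Θ)),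
      inner ℝ v (hf.toLp f) = ∫ x in Θ, inner ℝ (v x) (f x) := by
    intro v f hf
    rw [L2.inner_def]
    refine integral_congr_ae ?_
    filter_upwards [hf.coeFn_toLp] with x hx
    rw [hx]
  constructor
  · intro h φ h1 h2 hφ hc hs
    rw [key, key]
    exact h φ hφ hc hs
  · intro h φ hφ hc hs
    have := h φ (memLp_of_continuous_hasCompactSupport hφ.continuous hc)
      (memLp_of_continuous_hasCompactSupport (continuous_curl hφ) (hasCompactSupport_curl hc)) hφ hc hs
    rwa [key, key] at this

theorem hasWeakCurl_zero : HasWeakCurl (0 : VecL2 Θ) 0 :=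
  hasWeakCurl_iff.2 fun _ _ _ _ _ _ => by rw [inner_zero_left, inner_zero_left]

theorem hasWeakCurlZero_zero : HasWeakCurlZero (0 : VecL2 Θ) 0 :=
  ⟨hasWeakCurl_zero, fun _ _ _ => by rw [inner_zero_left, inner_zero_left]⟩

theorem hasWeakCurlZero_toLp {φ : E3 → E3} (hφ : ContDiff ℝ (⊤ : ℕ∞) φ)
    (hc : HasCompactSupport φ) (hs : tsupport φ ⊆ Θ)
    (h1 : MemLp φ 2 (volume.restrict Θ)) (h2 : MemLp (curl φ) 2 (volume.restrict Θ)) :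
    HasWeakCurlZero (h1.toLp φ) (h2.toLp (curl φ)) := by
  refine ⟨hasWeakCurl_toLp hφ hc h1 h2, fun ψ χ h => ?_⟩
  rw [real_inner_comm, real_inner_comm χ]
  exact hasWeakCurl_iff.1 h φ h1 h2 hφ hc hs

/-- The forward direction is Green's formula, used once for each pair of electric and magnetic
fields. Conversely, test pairs `(φ, 0)` and `(0, φ)` recover the two weak curls, and `(0, ψ)` with
`ψ ∈ H(curl)` recovers the boundary condition. No regularity of the boundary enters. -/
theorem isSkewAdjointRel_isMaxwell : IsSkewAdjointRel (IsMaxwell (Θ := Θ)) := by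
  intro u w
  simp only [WithLp.prod_inner_apply, WithLp.ofLp_fst, WithLp.ofLp_snd]
  constructor
  · rintro ⟨hH, hE⟩ v w' ⟨hH', hE'⟩
    have h1 := hE.2 _ _ hH'
    have h2 := hE'.2 _ _ hH
    rw [inner_neg_left] at h1 h2
    have h3 := real_inner_comm u.snd w'.snd
    have h4 := real_inner_comm v.fst w.fst
    linarith
  · intro h
    refine ⟨hasWeakCurl_iff.2 fun φ h1 h2 hφ hc hs => ?_, ?_, fun ψ χ hψ => ?_⟩
    · have := h (WithLp.toLp 2 (h1.toLp φ, 0)) (WithLp.toLp 2 (0, -h2.toLp (curl φ)))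
        ⟨hasWeakCurl_zero, by simpa using hasWeakCurlZero_toLp hφ hc hs h1 h2⟩
      simp only [WithLp.toLp_fst, WithLp.toLp_snd, inner_zero_right, inner_neg_right] at this
      linarith
    · refine hasWeakCurl_iff.2 fun φ h1 h2 hφ hc hs => ?_
      have := h (WithLp.toLp 2 (0, h1.toLp φ)) (WithLp.toLp 2 (h2.toLp (curl φ), 0))
        ⟨hasWeakCurl_toLp hφ hc h1 h2, by simpa using hasWeakCurlZero_zero⟩
      simp only [WithLp.toLp_fst, WithLp.toLp_snd, inner_zero_right] at this
      rw [inner_neg_left]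
      linarith
    · have := h (WithLp.toLp 2 (0, ψ)) (WithLp.toLp 2 (χ, 0))
        ⟨hψ, by simpa using hasWeakCurlZero_zero⟩
      simp only [WithLp.toLp_fst, WithLp.toLp_snd, inner_zero_right] at this
      rw [inner_neg_left]
      linarith

theorem IsSkewAdjointRel.const_smul {H : Type*} [NormedAddCommGroup H] [InnerProductSpace ℝ H]
    {Γ : H → H → Prop} (hΓ : IsSkewAdjointRel Γ) {c : ℝ} (hc : c ≠ 0) :
    IsSkewAdjointRel fun u w => Γ u (c • w) := by
  intro u w
  refine (hΓ _ _).trans ⟨fun h v w' hv => ?_, fun h v w' hv => ?_⟩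
  · have := h _ _ hv
    rw [real_inner_smul_left, real_inner_smul_right, ← mul_add] at this
    exact (mul_eq_zero.1 this).resolve_left hc
  · have := h v (c⁻¹ • w') (by simpa [smul_inv_smul₀ hc] using hv)
    rw [real_inner_smul_right] at this
    rw [real_inner_smul_left]
    field_simp at this
    linarith

end Maxwell

/-! ## Hemicontinuity of Nemytskij operators -/

section Nemytskij

/-- Vitali's theorem: on small sets the `L²` norm of `z` is small, so by Cauchy–Schwarz the products
with a bounded sequence are uniformly integrable. -/
theorem tendsto_inner_of_tendsto_ae {α E : Type*} {mα : MeasurableSpace α} {μ : Measure α}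
    [IsFiniteMeasure μ] [NormedAddCommGroup E] [InnerProductSpace ℝ E]
    {f : ℕ → Lp E 2 μ} {g : Lp E 2 μ} {C : ℝ} (hC : ∀ n, ‖f n‖ ≤ C)
    (hfg : ∀ᵐ x ∂μ, Tendsto (fun n => f n x) atTop (𝓝 (g x))) (z : Lp E 2 μ) :
    Tendsto (fun n => inner ℝ z (f n)) atTop (𝓝 (inner ℝ z g)) := by
  simp only [L2.inner_def]
  have hint : ∀ f : Lp E 2 μ, Integrable (fun x => inner ℝ (z x) (f x)) μ := fun f =>
    L2.integrable_inner z f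
  have hC0 : 0 ≤ C := (norm_nonneg _).trans (hC 0)
  have hui : UnifIntegrable (fun n x => inner ℝ (z x) (f n x)) 1 μ := by
    intro ε hε
    have hε' : 0 < ε / (C + 1) := by positivity
    obtain ⟨δ, hδ, h⟩ := (Lp.memLp z).eLpNorm_indicator_le (by norm_num) (by simp) hε'
    refine ⟨δ, hδ, fun n s hs hμs => ?_⟩
    have h1 : s.indicator (fun x => inner ℝ (z x) (f n x)) =
        fun x => inner ℝ (s.indicator z x) (f n x) := by
      ext x
      by_cases hx : x ∈ s <;> simp [hx]
    rw [h1]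
    have h2 := eLpNorm_le_eLpNorm_mul_eLpNorm'_of_norm (p := 2) (q := 2) (r := 1) (μ := μ)
      ((Lp.aestronglyMeasurable z).indicator hs) (Lp.aestronglyMeasurable (f n))
      (fun a b => inner ℝ a b) 1 (Eventually.of_forall fun x => by
        simpa using norm_inner_le_norm (𝕜 := ℝ) _ _)
    refine h2.trans ?_
    have h3 : eLpNorm (f n) 2 μ ≤ ENNReal.ofReal (C + 1) := by
      rw [← Lp.enorm_def, ← ofReal_norm]
      exact ENNReal.ofReal_le_ofReal ((hC n).trans (by linarith))
    calc _ ≤ ((1 : ℝ≥0) : ℝ≥0∞) * ENNReal.ofReal (ε / (C + 1)) * ENNReal.ofReal (C + 1) := by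
          gcongr
          exact h s hs hμs
      _ = ENNReal.ofReal ε := by
          rw [ENNReal.coe_one, one_mul, ← ENNReal.ofReal_mul hε'.le]
          congr 1
          field_simp
  refine tendsto_integral_of_L1' _ (hint g).aestronglyMeasurable
    (Eventually.of_forall fun n => hint (f n)) ?_
  refine tendsto_Lp_finite_of_tendsto_ae le_rfl (by simp) (fun n => (hint (f n)).1)
    (memLp_one_iff_integrable.2 (hint g)) hui ?_
  filter_upwards [hfg] with x hx
  exact tendsto_const_nhds.inner hx

theorem IsDriftNemytskij.tendsto_inner {Θ : Set E3} (hΘ : Bornology.IsBounded Θ)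
    {Je Jm : E3 → E3 → E3 → E3} (hJe : IsCaratheodory Θ Je) (hJm : IsCaratheodory Θ Jm)
    {F : Fields Θ → Fields Θ} (hF : IsDriftNemytskij Je Jm F) {α : ℝ}
    (hmono : ∀ u v, inner ℝ (u - v) (F u - F v) ≤ α * ‖u - v‖ ^ 2) (u z : Fields Θ) :
    Tendsto (fun n : ℕ => inner ℝ z (F (u - (1 / ((n : ℝ) + 1)) • z))) atTop
      (𝓝 (inner ℝ z (F u))) := by
  have : IsFiniteMeasure (volume.restrict Θ) :=
    ⟨by rw [Measure.restrict_apply_univ]; exact hΘ.measure_lt_top⟩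
  -- Local boundedness of `F` near `u`, which no hypothesis provides directly, comes from
  -- monotonicity of `α - F` translated to `u`.
  obtain ⟨r, C, hr, hC⟩ := exists_norm_le_of_monotone (G := fun v => α • (u + v) - F (u + v))
    (fun v w => by
      have h1 := hmono (u + v) (u + w)
      have h2 : α • (u + v) - F (u + v) - (α • (u + w) - F (u + w)) =
        α • (v - w) - (F (u + v) - F (u + w)) := by module
      rw [add_sub_add_left_eq_sub] at h1
      rw [h2, inner_sub_left, real_inner_smul_left, real_inner_self_eq_norm_sq,
        real_inner_comm (v - w)]
      linarith)
  set v : ℕ → Fields Θ := fun n => u - (1 / ((n : ℝ) + 1)) • z with hv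
  have hs : Tendsto (fun n : ℕ => 1 / ((n : ℝ) + 1)) atTop (𝓝 0) :=
    tendsto_one_div_add_atTop_nhds_zero_nat
  obtain ⟨N, hN⟩ : ∃ N : ℕ, ∀ n ≥ N, ‖(1 / ((n : ℝ) + 1)) • z‖ ≤ r := by
    have h1 : Tendsto (fun n : ℕ => ‖(1 / ((n : ℝ) + 1)) • z‖) atTop (𝓝 0) := by
      simpa using (hs.smul_const z).norm
    exact ((h1.eventually (gt_mem_nhds hr)).mono fun _ h => h.le).exists_forall_of_atTop
  have hFb : ∀ n, ‖F (v (n + N))‖ ≤ |α| * (‖u‖ + r) + C := by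
    intro n
    have h0 := hN (n + N) (Nat.le_add_left _ _)
    have h1 := hC (-((1 / (((n + N : ℕ) : ℝ) + 1)) • z)) (by rwa [norm_neg])
    simp only [← sub_eq_add_neg] at h1
    have h2 : ‖α • v (n + N)‖ ≤ |α| * (‖u‖ + r) := by
      rw [norm_smul, Real.norm_eq_abs]
      exact mul_le_mul_of_nonneg_left ((norm_sub_le _ _).trans (by linarith)) (abs_nonneg _)
    have h3 := norm_sub_le (α • v (n + N)) (α • v (n + N) - F (v (n + N)))
    rw [sub_sub_cancel] at h3
    exact h3.trans (add_le_add h2 h1)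
  have hfst : ∀ w : Fields Θ, ‖w.fst‖ ≤ ‖w‖ := fun w => by
    refine le_of_sq_le_sq ?_ (norm_nonneg _)
    rw [WithLp.prod_norm_sq_eq_of_L2]
    exact le_add_of_nonneg_right (sq_nonneg _)
  have hsnd : ∀ w : Fields Θ, ‖w.snd‖ ≤ ‖w‖ := fun w => by
    refine le_of_sq_le_sq ?_ (norm_nonneg _)
    rw [WithLp.prod_norm_sq_eq_of_L2]
    exact le_add_of_nonneg_left (sq_nonneg _)
  have hpt : ∀ a b : VecL2 Θ, ∀ᵐ x ∂(volume.restrict Θ), ∀ n : ℕ,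
      (a - (1 / ((n : ℝ) + 1)) • b : VecL2 Θ) x = a x - (1 / ((n : ℝ) + 1)) • b x := by
    intro a b
    refine ae_all_iff.2 fun n => ?_
    filter_upwards [Lp.coeFn_sub a ((1 / ((n : ℝ) + 1)) • b), Lp.coeFn_smul (1 / ((n : ℝ) + 1)) b]
      with x h1 h2
    rw [h1, Pi.sub_apply, h2, Pi.smul_apply]
  have hlim : ∀ a b : E3, Tendsto (fun n : ℕ => a - (1 / ((n : ℝ) + 1)) • b) atTop (𝓝 a) := by
    intro a b
    simpa using (hs.smul_const b).const_sub a
  have hae : ∀ᵐ x ∂(volume.restrict Θ),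
      Tendsto (fun n => (F (v n)).fst x) atTop (𝓝 ((F u).fst x)) ∧
      Tendsto (fun n => (F (v n)).snd x) atTop (𝓝 ((F u).snd x)) := by
    filter_upwards [hJe.continuous, hJm.continuous, hF u, ae_all_iff.2 fun n => hF (v n),
      hpt u.fst z.fst, hpt u.snd z.snd] with x c1 c2 h0 h h1 h2
    have hz : Tendsto (fun n => ((v n).fst x, (v n).snd x)) atTop (𝓝 (u.fst x, u.snd x)) := by
      refine Tendsto.prodMk_nhds ?_ ?_
      · exact (hlim _ _).congr fun n => (h1 n).symm
      · exact (hlim _ _).congr fun n => (h2 n).symm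
    constructor
    · rw [h0.1]
      exact ((c1.tendsto _).comp hz).neg.congr fun n => (h n).1.symm
    · rw [h0.2]
      exact ((c2.tendsto _).comp hz).neg.congr fun n => (h n).2.symm
  rw [← tendsto_add_atTop_iff_nat N]
  simp only [WithLp.prod_inner_apply, WithLp.ofLp_fst, WithLp.ofLp_snd]
  refine Tendsto.add ?_ ?_
  · refine tendsto_inner_of_tendsto_ae (f := fun n => (F (v (n + N))).fst)
      (fun n => (hfst _).trans (hFb n)) ?_ z.fst
    filter_upwards [hae] with x hx
    exact (tendsto_add_atTop_iff_nat N).2 hx.1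
  · refine tendsto_inner_of_tendsto_ae (f := fun n => (F (v (n + N))).snd)
      (fun n => (hsnd _).trans (hFb n)) ?_ z.snd
    filter_upwards [hae] with x hx
    exact (tendsto_add_atTop_iff_nat N).2 hx.2

end Nemytskij

/-! ## The implicit step -/

section Resolvent

variable {Θ : Set E3} {F : Fields Θ → Fields Θ} {α σ h : ℝ}

/-- `u` solves the implicit equation with right-hand side `g`. -/
def IsStep (F : Fields Θ → Fields Θ) (σ h : ℝ) (g u : Fields Θ) : Prop :=
  ∃ w, IsMaxwell u w ∧ u - g = h • w - (σ * h) • u + h • F u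

/-- The difference of the two equations is tested with `u - u'`: the Maxwell term vanishes and the
drift has a favourable sign, leaving `‖u - u'‖² ≤ ⟨u - u', g - g'⟩`. -/
theorem IsStep.norm_sub_le (hmono : ∀ u v, inner ℝ (u - v) (F u - F v) ≤ α * ‖u - v‖ ^ 2)
    (hσ : α ≤ σ) (hh : 0 ≤ h) {g u g' u' : Fields Θ} (hu : IsStep F σ h g u)
    (hu' : IsStep F σ h g' u') : ‖u - u'‖ ≤ ‖g - g'‖ := by
  obtain ⟨w, hw, e⟩ := hu
  obtain ⟨w', hw', e'⟩ := hu'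
  have h1 : g - g' = (u - u') - h • (w - w') + (σ * h) • (u - u') - h • (F u - F u') := by
    have e1 : g = u - (h • w - (σ * h) • u + h • F u) := by rw [← e]; abel
    have e2 : g' = u' - (h • w' - (σ * h) • u' + h • F u') := by rw [← e']; abel
    rw [e1, e2]
    module
  have h2 := isSkewAdjointRel_isMaxwell.inner_eq_zero (isSkewAdjointRel_isMaxwell.sub hw hw')
  have h3 := real_inner_le_norm (u - u') (g - g')
  rw [h1, inner_sub_right, inner_add_right, inner_sub_right, real_inner_smul_right, h2,
    real_inner_smul_right, real_inner_smul_right, real_inner_self_eq_norm_sq, ← h1] at h3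
  have h4 := mul_le_mul_of_nonneg_left (hmono u u') hh
  have h5 : h * (α * ‖u - u'‖ ^ 2) ≤ h * (σ * ‖u - u'‖ ^ 2) :=
    mul_le_mul_of_nonneg_left (mul_le_mul_of_nonneg_right hσ (sq_nonneg _)) hh
  have h6 : ‖u - u'‖ * ‖u - u'‖ ≤ ‖u - u'‖ * ‖g - g'‖ := by nlinarith
  rcases (norm_nonneg (u - u')).eq_or_lt with h0 | h0
  · rw [← h0]
    exact norm_nonneg _
  · exact le_of_mul_le_mul_left h6 h0

theorem exists_isStep (hΘ : Bornology.IsBounded Θ)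
    {Je Jm : E3 → E3 → E3 → E3} (hJe : IsCaratheodory Θ Je) (hJm : IsCaratheodory Θ Jm)
    (hF : IsDriftNemytskij Je Jm F)
    (hmono : ∀ u v, inner ℝ (u - v) (F u - F v) ≤ α * ‖u - v‖ ^ 2)
    (hσ : α ≤ σ) (hh : 0 < h) (g : Fields Θ) : ∃ u, IsStep F σ h g u := by
  -- The factor `-h⁻¹` turns the relation into `m = -h M u`.
  obtain ⟨u, m, hm, e⟩ := (isSkewAdjointRel_isMaxwell.const_smul
    (neg_ne_zero.2 (inv_ne_zero hh.ne'))).exists_solution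
    (G := fun u => (σ * h) • u - h • F u) (fun u v => by
      have h1 : (σ * h) • u - h • F u - ((σ * h) • v - h • F v) =
        (σ * h) • (u - v) - h • (F u - F v) := by module
      rw [h1, inner_sub_left, real_inner_smul_left, real_inner_smul_left,
        real_inner_self_eq_norm_sq, real_inner_comm (u - v)]
      have h4 := mul_le_mul_of_nonneg_left (hmono u v) hh.le
      have h5 : h * (α * ‖u - v‖ ^ 2) ≤ h * (σ * ‖u - v‖ ^ 2) :=
        mul_le_mul_of_nonneg_left (mul_le_mul_of_nonneg_right hσ (sq_nonneg _)) hh.le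
      linarith) (fun u z => by
      simp only [inner_sub_right, real_inner_smul_right]
      have hs : Tendsto (fun n : ℕ => 1 / ((n : ℝ) + 1)) atTop (𝓝 0) :=
        tendsto_one_div_add_atTop_nhds_zero_nat
      refine Tendsto.sub (Tendsto.const_mul _ ?_)
        ((hF.tendsto_inner hΘ hJe hJm hmono u z).const_mul h)
      simpa using (hs.mul_const (inner ℝ z z)).const_sub (inner ℝ z u)) g
  refine ⟨u, _, hm, ?_⟩
  rw [neg_smul, smul_neg, smul_inv_smul₀ hh.ne', ← e]
  module

end Resolvent

/-! ## Moments of Gaussian sums in a Hilbert space -/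

section Gaussian

variable {Ω : Type*} {mΩ : MeasurableSpace Ω} {P : Measure Ω}

/-- Jensen's inequality for the `q`-th power, with weights proportional to `A i` and values
proportional to `x i / A i`. With `A i` bounding an `L^q` norm it integrates to Minkowski's
inequality. -/
theorem sum_pow_le_sum_pow_mul {ι : Type*} (s : Finset ι) {A x : ι → ℝ} (hA : ∀ i ∈ s, 0 < A i)
    (hx : ∀ i ∈ s, 0 ≤ x i) {q : ℕ} (hq : 1 ≤ q) :
    (∑ i ∈ s, x i) ^ q ≤ ∑ i ∈ s, (∑ i ∈ s, A i) ^ q * (A i / ∑ i ∈ s, A i) * (x i ^ q / A i ^ q) := by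
  rcases s.eq_empty_or_nonempty with rfl | hs
  · simp [Nat.pos_iff_ne_zero.1 hq]
  have hpos : 0 < ∑ i ∈ s, A i := Finset.sum_pos hA hs
  have h1 := Real.pow_arith_mean_le_arith_mean_pow s (fun i => A i / ∑ i ∈ s, A i)
    (fun i => (∑ i ∈ s, A i) * (x i / A i)) (fun i hi => div_nonneg (hA i hi).le hpos.le)
    (by rw [← Finset.sum_div, div_self hpos.ne'])
    (fun i hi => mul_nonneg hpos.le (div_nonneg (hx i hi) (hA i hi).le)) q
  refine le_trans (le_of_eq ?_) (h1.trans (le_of_eq ?_))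
  · congr 1
    refine Finset.sum_congr rfl fun i hi => ?_
    have := (hA i hi).ne'
    field_simp
  · refine Finset.sum_congr rfl fun i hi => ?_
    rw [mul_pow, div_pow]
    ring

/-- The triangle inequality in `L^q`, in terms of moments. -/
theorem integral_sum_pow_le {ι : Type*} (s : Finset ι) {X : ι → Ω → ℝ} {A : ι → ℝ} {M : ℝ} {q : ℕ}
    (hq : 1 ≤ q) (hM : 0 ≤ M) (hA : ∀ i ∈ s, 0 < A i) (hX : ∀ i ∈ s, ∀ ω, 0 ≤ X i ω)
    (hmeas : ∀ i ∈ s, AEStronglyMeasurable (X i) P)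
    (hint : ∀ i ∈ s, Integrable (fun ω => X i ω ^ q) P)
    (h : ∀ i ∈ s, ∫ ω, X i ω ^ q ∂P ≤ M * A i ^ q) :
    Integrable (fun ω => (∑ i ∈ s, X i ω) ^ q) P ∧
      ∫ ω, (∑ i ∈ s, X i ω) ^ q ∂P ≤ M * (∑ i ∈ s, A i) ^ q := by
  have hle : ∀ ω, (∑ i ∈ s, X i ω) ^ q ≤
      ∑ i ∈ s, (∑ i ∈ s, A i) ^ q * (A i / ∑ i ∈ s, A i) * (X i ω ^ q / A i ^ q) := fun ω =>
    sum_pow_le_sum_pow_mul s hA (fun i hi => hX i hi ω) hq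
  have hi : ∀ i ∈ s, Integrable (fun ω => (∑ i ∈ s, A i) ^ q * (A i / ∑ i ∈ s, A i) *
      (X i ω ^ q / A i ^ q)) P := fun i his => ((hint i his).div_const _).const_mul _
  have hI : Integrable (fun ω => (∑ i ∈ s, X i ω) ^ q) P := by
    refine (integrable_finsetSum s hi).mono' ?_ (Eventually.of_forall fun ω => ?_)
    · exact (Finset.aestronglyMeasurable_fun_sum s hmeas).pow q
    · rw [Real.norm_eq_abs, abs_of_nonneg (pow_nonneg (Finset.sum_nonneg fun i hi => hX i hi ω) q)]
      exact hle ω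
  refine ⟨hI, (integral_mono hI (integrable_finsetSum s hi) hle).trans ?_⟩
  rw [integral_finsetSum s hi]
  rcases s.eq_empty_or_nonempty with rfl | hs
  · simpa using mul_nonneg hM (pow_nonneg le_rfl q)
  have hpos : 0 < ∑ i ∈ s, A i := Finset.sum_pos hA hs
  calc _ ≤ ∑ i ∈ s, (∑ i ∈ s, A i) ^ q * (A i / ∑ i ∈ s, A i) * M := by
        refine Finset.sum_le_sum fun i his => ?_
        rw [integral_const_mul, integral_div]
        refine mul_le_mul_of_nonneg_left ?_
          (mul_nonneg (pow_nonneg hpos.le q) (div_nonneg (hA i his).le hpos.le))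
        rw [div_le_iff₀ (pow_pos (hA i his) q)]
        exact h i his
    _ = M * (∑ i ∈ s, A i) ^ q := by
        rw [← Finset.sum_mul, ← Finset.mul_sum, ← Finset.sum_div, div_self hpos.ne']
        ring

/-- The even moments of the standard normal distribution. -/
noncomputable def stdMoment (q : ℕ) : ℝ := ∫ x, x ^ (2 * q) ∂(gaussianReal 0 1)

theorem stdMoment_nonneg (q : ℕ) : 0 ≤ stdMoment q :=
  integral_nonneg fun x => by rw [pow_mul]; positivity

theorem stdMoment_one : stdMoment 1 = 1 := by
  have h1 := variance_fun_id_gaussianReal (μ := 0) (v := 1)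
  rw [variance_of_integral_eq_zero (by fun_prop) (by simp)] at h1
  simpa [stdMoment] using h1

theorem integrable_pow_of_map_eq_gaussianReal {X : Ω → ℝ} (hX : Measurable X) {v : ℝ≥0}
    (h : P.map X = gaussianReal 0 v) (n : ℕ) : Integrable (fun ω => X ω ^ n) P := by
  have h1 : Integrable (fun x : ℝ => x ^ n) (gaussianReal 0 v) := by
    rcases Nat.eq_zero_or_pos n with rfl | hn
    · simp
    have h0 := (memLp_id_gaussianReal (μ := 0) (v := v) (n : ℝ≥0))
    have := h0.integrable_norm_pow (p := n) (by omega)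
    refine (integrable_norm_iff (by fun_prop)).1 ?_
    simpa using this
  rw [← h] at h1
  exact h1.comp_measurable hX

theorem integral_pow_of_map_eq_gaussianReal {X : Ω → ℝ} (hX : Measurable X) {v : ℝ≥0}
    (h : P.map X = gaussianReal 0 v) (q : ℕ) :
    ∫ ω, X ω ^ (2 * q) ∂P = stdMoment q * (v : ℝ) ^ q := by
  have h1 : ∫ ω, X ω ^ (2 * q) ∂P = ∫ x, x ^ (2 * q) ∂(gaussianReal 0 v) := by
    rw [← h, integral_map hX.aemeasurable (by fun_prop)]
  have h2 : gaussianReal 0 v = (gaussianReal 0 1).map fun x => Real.sqrt v * x := by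
    rw [gaussianReal_map_const_mul, mul_zero, mul_one]
    congr 1
    ext
    simp
  rw [h1, h2, integral_map (by fun_prop) (by fun_prop), stdMoment, ← integral_mul_const]
  refine integral_congr_ae (Eventually.of_forall fun x => ?_)
  simp only
  rw [mul_pow, pow_mul (Real.sqrt v), Real.sq_sqrt v.coe_nonneg, mul_comm]

/-- A sequence of independent centred Gaussian variables of variance `h`. -/
structure IsGaussianSeq (P : Measure Ω) (h : ℝ≥0) (ξ : ℕ → Ω → ℝ) : Prop where
  measurable : ∀ j, Measurable (ξ j)
  law : ∀ j, P.map (ξ j) = gaussianReal 0 h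
  indep : iIndepFun ξ P

namespace IsGaussianSeq

variable {h : ℝ≥0} {ξ : ℕ → Ω → ℝ} {V : Type*} [NormedAddCommGroup V] [InnerProductSpace ℝ V]

theorem integral_inner_sum (hξ : IsGaussianSeq P h ξ) (a : ℕ → V) (J : Finset ℕ) (x : V) :
    Integrable (fun ω => inner ℝ x (∑ j ∈ J, ξ j ω • a j)) P ∧
      ∫ ω, inner ℝ x (∑ j ∈ J, ξ j ω • a j) ∂P = 0 := by
  have h0 : ∀ j, Integrable (ξ j) P := fun j => by
    simpa using integrable_pow_of_map_eq_gaussianReal (hξ.measurable j) (hξ.law j) 1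
  simp only [inner_sum, real_inner_smul_right]
  refine ⟨integrable_finsetSum J fun j _ => (h0 j).mul_const _, ?_⟩
  rw [integral_finsetSum J fun j _ => (h0 j).mul_const _]
  refine Finset.sum_eq_zero fun j _ => ?_
  have h1 : ∫ ω, ξ j ω ∂P = ∫ x, x ∂(P.map (ξ j)) := by
    rw [integral_map (hξ.measurable j).aemeasurable (by fun_prop)]
  rw [integral_mul_const, h1, hξ.law, integral_id_gaussianReal, zero_mul]

variable [IsProbabilityMeasure P]

theorem map_sum (hξ : IsGaussianSeq P h ξ) (c : ℕ → ℝ) (J : Finset ℕ) :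
    P.map (fun ω => ∑ j ∈ J, c j * ξ j ω) = gaussianReal 0 (h * ∑ j ∈ J, ‖c j‖₊ ^ 2) := by
  induction J using Finset.induction_on with
  | empty => simp [Measure.map_const]
  | insert j J hj ih =>
    have hind : iIndepFun (fun i ω => c i * ξ i ω) P :=
      hξ.indep.comp (fun i x => c i * x) fun i => measurable_const_mul (c i)
    have hm : ∀ i, Measurable fun ω => c i * ξ i ω := fun i => (hξ.measurable i).const_mul (c i)
    have h1 := (hind.indepFun_finsetSum_of_notMem hm hj)
    have h2 : P.map (fun ω => c j * ξ j ω) = gaussianReal 0 (h * ‖c j‖₊ ^ 2) := by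
      have : P.map (fun ω => c j * ξ j ω) = (P.map (ξ j)).map fun x => c j * x := by
        rw [Measure.map_map (measurable_const_mul _) (hξ.measurable j)]
        rfl
      rw [this, hξ.law, gaussianReal_map_const_mul, mul_zero]
      congr 1
      ext
      simp [mul_comm]
    have h3 : (∑ i ∈ J, fun ω => c i * ξ i ω) = fun ω => ∑ i ∈ J, c i * ξ i ω := by
      ext ω
      simp
    rw [h3] at h1
    have h4 := gaussianReal_add_gaussianReal_of_indepFun h1 ih h2
    rw [Finset.sum_insert hj]
    rw [zero_add] at h4
    rw [mul_add, add_comm, ← h4]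
    congr 1
    ext ω
    rw [Finset.sum_insert hj, Pi.add_apply, add_comm]

/-- Each coordinate of the sum is a centred Gaussian with known moments. The triangle inequality in
`L^q` for the squared coordinates adds up their variances, and Parseval evaluates the total;
independence of the coordinates is not needed. -/
theorem norm_sum_pow_of_finiteDimensional [FiniteDimensional ℝ V] (hξ : IsGaussianSeq P h ξ)
    (a : ℕ → V) (J : Finset ℕ) {q : ℕ} (hq : 1 ≤ q) :
    Integrable (fun ω => ‖∑ j ∈ J, ξ j ω • a j‖ ^ (2 * q)) P ∧
      ∫ ω, ‖∑ j ∈ J, ξ j ω • a j‖ ^ (2 * q) ∂P ≤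
        stdMoment q * (h * ∑ j ∈ J, ‖a j‖ ^ 2) ^ q := by
  set b := stdOrthonormalBasis ℝ V
  set X : Fin (Module.finrank ℝ V) → Ω → ℝ := fun i ω => ∑ j ∈ J, inner ℝ (b i) (a j) * ξ j ω
  have hXm : ∀ i, Measurable (X i) := fun i =>
    Finset.measurable_fun_sum J fun j _ => (hξ.measurable j).const_mul _
  have hX : ∀ i, P.map (X i) = _ := fun i => hξ.map_sum (fun j => inner ℝ (b i) (a j)) J
  have hS : ∀ ω, ‖∑ j ∈ J, ξ j ω • a j‖ ^ (2 * q) = (∑ i, X i ω ^ 2) ^ q := by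
    intro ω
    rw [pow_mul, ← b.sum_sq_norm_inner_right]
    congr 1
    refine Finset.sum_congr rfl fun i _ => ?_
    rw [inner_sum, Real.norm_eq_abs, sq_abs]
    congr 1
    refine Finset.sum_congr rfl fun j _ => ?_
    rw [real_inner_smul_right, mul_comm]
  simp only [hS]
  set v : Fin (Module.finrank ℝ V) → ℝ := fun i => h * ∑ j ∈ J, (inner ℝ (b i) (a j)) ^ 2
  have hv0 : ∀ i, 0 ≤ v i := fun i => by positivity
  have hv : ∑ i, v i = h * ∑ j ∈ J, ‖a j‖ ^ 2 := by
    rw [← Finset.mul_sum, Finset.sum_comm]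
    congr 1
    refine Finset.sum_congr rfl fun j _ => ?_
    rw [← b.sum_sq_norm_inner_right]
    simp
  -- The weights must be positive while a coordinate may have variance zero, hence the `ε`, removed
  -- in the limit.
  have key : ∀ ε : ℝ, 0 < ε → Integrable (fun ω => (∑ i, X i ω ^ 2) ^ q) P ∧
      ∫ ω, (∑ i, X i ω ^ 2) ^ q ∂P ≤ stdMoment q * (∑ i, (v i + ε)) ^ q := by
    intro ε hε
    refine integral_sum_pow_le Finset.univ hq (stdMoment_nonneg q)
      (fun i _ => add_pos_of_nonneg_of_pos (hv0 i) hε) (fun i _ ω => sq_nonneg _)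
      (fun i _ => ((hXm i).pow_const 2).aestronglyMeasurable) (fun i _ => ?_) (fun i _ => ?_)
    · simp only [← pow_mul]
      exact integrable_pow_of_map_eq_gaussianReal (hXm i) (hX i) _
    · simp only [← pow_mul]
      rw [integral_pow_of_map_eq_gaussianReal (hXm i) (hX i)]
      refine mul_le_mul_of_nonneg_left (pow_le_pow_left₀ (by positivity) ?_ q) (stdMoment_nonneg q)
      simp [v, hε.le]
  refine ⟨(key 1 one_pos).1, ?_⟩
  rw [← hv]
  have hlim : Tendsto (fun n : ℕ => stdMoment q * (∑ i, (v i + 1 / ((n : ℝ) + 1))) ^ q) atTop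
      (𝓝 (stdMoment q * (∑ i, (v i + 0)) ^ q)) :=
    ((tendsto_finsetSum _ fun i _ =>
      tendsto_one_div_add_atTop_nhds_zero_nat.const_add (v i)).pow q).const_mul _
  simp only [add_zero] at hlim
  exact ge_of_tendsto' hlim fun n => (key _ (by positivity)).2

/-- Finitely many coefficients span a finite-dimensional subspace. -/
theorem norm_sum_pow (hξ : IsGaussianSeq P h ξ)
    (a : ℕ → V) (J : Finset ℕ) {q : ℕ} (hq : 1 ≤ q) :
    Integrable (fun ω => ‖∑ j ∈ J, ξ j ω • a j‖ ^ (2 * q)) P ∧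
      ∫ ω, ‖∑ j ∈ J, ξ j ω • a j‖ ^ (2 * q) ∂P ≤
        stdMoment q * (h * ∑ j ∈ J, ‖a j‖ ^ 2) ^ q := by
  classical
  set U : Submodule ℝ V := Submodule.span ℝ (J.image a)
  have hU : ∀ j ∈ J, a j ∈ U := fun j hj =>
    Submodule.subset_span (Finset.mem_coe.2 (Finset.mem_image_of_mem a hj))
  set a' : ℕ → U := fun j => if hj : a j ∈ U then ⟨a j, hj⟩ else 0 with ha'
  have haa : ∀ j ∈ J, (a' j : V) = a j := fun j hj => by simp [ha', hU j hj]
  have h1 := hξ.norm_sum_pow_of_finiteDimensional a' J hq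
  have h2 : ∀ ω, ‖∑ j ∈ J, ξ j ω • a j‖ = ‖∑ j ∈ J, ξ j ω • a' j‖ := by
    intro ω
    rw [Submodule.coe_norm, Submodule.coe_sum]
    congr 1
    refine Finset.sum_congr rfl fun j hj => ?_
    rw [Submodule.coe_smul, haa j hj]
  have h3 : ∑ j ∈ J, ‖a j‖ ^ 2 = ∑ j ∈ J, ‖a' j‖ ^ 2 :=
    Finset.sum_congr rfl fun j hj => by rw [Submodule.coe_norm, haa j hj]
  simp only [h2, h3]
  exact h1

end IsGaussianSeq

end Gaussian

/-! ## Growth of moments in one step -/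

section OneStep

theorem choose_mul_pow_le {y Y : ℝ} (hy : 0 ≤ y) (hY : 0 ≤ Y) (q : ℕ) :
    (q.choose 2 : ℝ) * y ^ (q - 2) * Y ^ 2 ≤ (y + Y) ^ q := by
  rcases lt_or_ge q 2 with h | h
  · rw [Nat.choose_eq_zero_of_lt h]
    simp only [Nat.cast_zero, zero_mul]
    positivity
  · rw [add_comm, add_pow]
    refine le_trans (le_of_eq ?_) (Finset.single_le_sum
      (f := fun m => Y ^ m * y ^ (q - m) * (q.choose m : ℝ)) (fun i _ => by positivity)
      (Finset.mem_range.2 (by omega : 2 < q + 1)))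
    ring

/-- Every binomial term of order at least three in `z` carries a factor `r ^ 3`; what remains is
part of the expansion of `(y + Y) ^ q`. -/
theorem add_pow_le_taylor {y z Y r : ℝ} (hy : 0 ≤ y) (hY : 0 ≤ Y) (hr0 : 0 ≤ r) (hr1 : r ≤ 1)
    (hz : |z| ≤ r * Y) (q : ℕ) :
    (y + z) ^ q ≤ y ^ q + q * y ^ (q - 1) * z + q.choose 2 * y ^ (q - 2) * z ^ 2
      + r ^ 3 * (y + Y) ^ q := by
  -- The range is padded by vanishing binomial coefficients so that three terms can be split off
  -- even when `q < 2`.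
  have hexp : ∀ t : ℝ, (y + t) ^ q =
      ∑ m ∈ Finset.range (q + 3), t ^ m * y ^ (q - m) * (q.choose m : ℝ) := by
    intro t
    rw [add_comm, add_pow]
    refine Finset.sum_subset (Finset.range_subset_range.2 (by omega)) fun m _ hm => ?_
    rw [Nat.choose_eq_zero_of_lt (by simpa [Nat.lt_succ_iff] using hm)]
    simp
  have hY3 : ∑ m ∈ Finset.range q, Y ^ (m + 3) * y ^ (q - (m + 3)) * (q.choose (m + 3) : ℝ) ≤
      (y + Y) ^ q := by
    rw [hexp Y, Finset.sum_range_succ', Finset.sum_range_succ', Finset.sum_range_succ']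
    have h0 : 0 ≤ Y ^ (0 + 1 + 1) * y ^ (q - (0 + 1 + 1)) * (q.choose (0 + 1 + 1) : ℝ) := by
      positivity
    have h1 : 0 ≤ Y ^ (0 + 1) * y ^ (q - (0 + 1)) * (q.choose (0 + 1) : ℝ) := by positivity
    have h2 : 0 ≤ Y ^ 0 * y ^ (q - 0) * (q.choose 0 : ℝ) := by positivity
    simp only [add_assoc, Nat.reduceAdd] at h0 h1 h2 ⊢
    linarith
  have hterm : ∀ m ∈ Finset.range q, z ^ (m + 3) * y ^ (q - (m + 3)) * (q.choose (m + 3) : ℝ) ≤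
      r ^ 3 * (Y ^ (m + 3) * y ^ (q - (m + 3)) * (q.choose (m + 3) : ℝ)) := by
    intro m _
    rw [← mul_assoc, ← mul_assoc]
    refine mul_le_mul_of_nonneg_right (mul_le_mul_of_nonneg_right ?_ (by positivity))
      (by positivity)
    calc z ^ (m + 3) ≤ |z| ^ (m + 3) := by rw [← abs_pow]; exact le_abs_self _
      _ ≤ (r * Y) ^ (m + 3) := pow_le_pow_left₀ (abs_nonneg _) hz _
      _ = r ^ m * (r ^ 3 * Y ^ (m + 3)) := by rw [mul_pow, pow_add]; ring
      _ ≤ r ^ 3 * Y ^ (m + 3) := mul_le_of_le_one_left (by positivity) (pow_le_one₀ hr0 hr1)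
  have hsum := Finset.sum_le_sum hterm
  rw [← Finset.mul_sum] at hsum
  have hmul := mul_le_mul_of_nonneg_left hY3 (pow_nonneg hr0 3)
  rw [hexp z, Finset.sum_range_succ', Finset.sum_range_succ', Finset.sum_range_succ']
  simp only [add_assoc, Nat.reduceAdd, zero_add, pow_zero, pow_one, tsub_zero, Nat.choose_zero_right,
    Nat.choose_one_right, Nat.cast_one] at hsum hmul ⊢
  linarith

theorem three_add_pow_le {a b c : ℝ} (ha : 0 ≤ a) (hb : 0 ≤ b) (hc : 0 ≤ c) (q : ℕ) :
    (a + b + c) ^ q ≤ 3 ^ q * (a ^ q + b ^ q + c ^ q) := by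
  have key : ∀ m : ℝ, 0 ≤ m → a ≤ m → b ≤ m → c ≤ m → m ^ q ≤ a ^ q + b ^ q + c ^ q →
      (a + b + c) ^ q ≤ 3 ^ q * (a ^ q + b ^ q + c ^ q) := by
    intro m hm h1 h2 h3 h4
    calc (a + b + c) ^ q ≤ (3 * m) ^ q := pow_le_pow_left₀ (by positivity) (by linarith) q
      _ = 3 ^ q * m ^ q := mul_pow _ _ _
      _ ≤ _ := mul_le_mul_of_nonneg_left h4 (by positivity)
  have pa := pow_nonneg ha q
  have pb := pow_nonneg hb q
  have pc := pow_nonneg hc q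
  rcases le_total a b with hab | hab <;> rcases le_total b c with hbc | hbc <;>
    rcases le_total a c with hac | hac
  · exact key c hc hac hbc le_rfl (by linarith)
  · exact key c hc (hab.trans hbc) hbc le_rfl (by linarith)
  · exact key b hb hab le_rfl hbc (by linarith)
  · exact key b hb hab le_rfl hbc (by linarith)
  · exact key c hc hac hbc le_rfl (by linarith)
  · exact key a ha le_rfl hab hac (by linarith)
  · exact key a ha le_rfl hab (hbc.trans hab) (by linarith)
  · exact key a ha le_rfl hab hac (by linarith)

variable {V : Type*} [NormedAddCommGroup V] [InnerProductSpace ℝ V]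

/-- Here `r` will be the square root of the step and `S = O(r)`. The base is `‖x‖² + z` with `z =
O(r)`. The coefficient `q(2q-1)` is `q` from the linear term plus `2q(q-1)` from the square of `2⟨x,
S⟩`; the rest is `O(r³)`. -/
theorem norm_add_sq_add_pow_le {f r : ℝ} (hf : 0 ≤ f) (hr0 : 0 < r) (hr1 : r ≤ 1) {q : ℕ}
    (hq : 1 ≤ q) (x S : V) :
    (‖x + S‖ ^ 2 + 2 * f * r ^ 2) ^ q ≤ ‖x‖ ^ (2 * q)
      + 2 * q * ‖x‖ ^ (2 * (q - 1)) * inner ℝ x S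
      + q * (2 * q - 1) * ‖x‖ ^ (2 * (q - 1)) * ‖S‖ ^ 2
      + 2 * q * f * r ^ 2 * ‖x‖ ^ (2 * (q - 1))
      + 2 * r ^ 3 * 6 ^ q * (‖x‖ ^ (2 * q) + ‖S‖ ^ (2 * q) / (r ^ 2) ^ q + f ^ q) := by
  set g : ℝ := ‖S‖ / r with hg
  have hg0 : 0 ≤ g := by positivity
  have hS : ‖S‖ = r * g := by rw [hg]; field_simp
  have hSq : ‖S‖ ^ (2 * q) / (r ^ 2) ^ q = (g ^ 2) ^ q := by
    rw [hS, pow_mul, mul_pow, mul_pow]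
    field_simp
  set y : ℝ := ‖x‖ ^ 2 with hy
  set b : ℝ := 2 * inner ℝ x S with hb
  set Z : ℝ := g ^ 2 + 2 * f with hZ
  set Y : ℝ := 2 * ‖x‖ * g + Z with hY
  have hx0 := norm_nonneg x
  have hy0 : 0 ≤ y := by positivity
  have hZ0 : 0 ≤ Z := by positivity
  have hY0 : 0 ≤ Y := by positivity
  have hbabs : |b| ≤ r * (2 * ‖x‖ * g) := by
    rw [hb, abs_mul, abs_two]
    have := abs_real_inner_le_norm x S
    rw [hS] at this
    nlinarith
  have hr2 : r ^ 2 ≤ r := by nlinarith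
  have hz : |b + r ^ 2 * Z| ≤ r * Y := by
    refine (abs_add_le _ _).trans ?_
    rw [abs_of_nonneg (by positivity : 0 ≤ r ^ 2 * Z), hY, mul_add r]
    exact add_le_add hbabs (mul_le_mul_of_nonneg_right hr2 hZ0)
  have hz2 : (b + r ^ 2 * Z) ^ 2 ≤ 4 * y * ‖S‖ ^ 2 + r ^ 3 * Y ^ 2 := by
    have h1 : b ^ 2 ≤ (r * (2 * ‖x‖ * g)) ^ 2 := sq_le_sq' (by linarith [neg_abs_le b]) (by
      linarith [le_abs_self b])
    have h2 : b * (r ^ 2 * Z) ≤ r * (2 * ‖x‖ * g) * (r ^ 2 * Z) :=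
      mul_le_mul_of_nonneg_right ((le_abs_self b).trans hbabs) (by positivity)
    have h3 : r ^ 4 * Z ^ 2 ≤ r ^ 3 * Z ^ 2 :=
      mul_le_mul_of_nonneg_right (pow_le_pow_of_le_one hr0.le hr1 (by norm_num)) (sq_nonneg _)
    have h4 : 0 ≤ r ^ 3 * (2 * ‖x‖ * g) ^ 2 := by positivity
    have h5 : (r * (2 * ‖x‖ * g)) ^ 2 = 4 * ‖x‖ ^ 2 * (r * g) ^ 2 := by ring
    have h6 : (b + r ^ 2 * Z) ^ 2 = b ^ 2 + 2 * (b * (r ^ 2 * Z)) + r ^ 4 * Z ^ 2 := by ring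
    have h7 : r ^ 3 * (2 * ‖x‖ * g + Z) ^ 2 = r ^ 3 * (2 * ‖x‖ * g) ^ 2 +
      2 * (r * (2 * ‖x‖ * g) * (r ^ 2 * Z)) + r ^ 3 * Z ^ 2 := by ring
    rw [hS, hy, hY, h7, h6]
    linarith
  have hLHS : ‖x + S‖ ^ 2 + 2 * f * r ^ 2 = y + (b + r ^ 2 * Z) := by
    rw [norm_add_sq_real, hS]
    ring
  have hT := add_pow_le_taylor hy0 hY0 hr0.le hr1 hz q
  have hC := choose_mul_pow_le hy0 hY0 q
  have hsec : (q.choose 2 : ℝ) * y ^ (q - 2) * (b + r ^ 2 * Z) ^ 2 ≤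
      2 * q * (q - 1) * y ^ (q - 1) * ‖S‖ ^ 2 + r ^ 3 * (y + Y) ^ q := by
    have h1 := mul_le_mul_of_nonneg_left hz2 (by positivity : 0 ≤ (q.choose 2 : ℝ) * y ^ (q - 2))
    have h2 : (q.choose 2 : ℝ) * y ^ (q - 2) * (4 * y * ‖S‖ ^ 2) =
        2 * q * (q - 1) * y ^ (q - 1) * ‖S‖ ^ 2 := by
      rw [Nat.cast_choose_two]
      rcases hq.eq_or_lt with rfl | h
      · simp
      · obtain ⟨n, rfl⟩ : ∃ n, q = n + 2 := ⟨q - 2, by omega⟩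
        have : n + 2 - 1 = n + 1 := by omega
        rw [this, Nat.add_sub_cancel, pow_succ]
        ring
    have h3 := mul_le_mul_of_nonneg_left hC (pow_nonneg hr0.le 3)
    rw [mul_add _ (4 * y * ‖S‖ ^ 2), h2] at h1
    have h4 : (q.choose 2 : ℝ) * y ^ (q - 2) * (r ^ 3 * Y ^ 2) =
      r ^ 3 * (q.choose 2 * y ^ (q - 2) * Y ^ 2) := by ring
    linarith
  have hfin : (y + Y) ^ q ≤ 6 ^ q * (y ^ q + (g ^ 2) ^ q + f ^ q) := by
    have h1 : y + Y ≤ 2 * (y + g ^ 2 + f) := by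
      rw [hY, hZ, hy]
      linarith [two_mul_le_add_sq ‖x‖ g]
    have h2 := three_add_pow_le hy0 (sq_nonneg g) hf q
    calc (y + Y) ^ q ≤ (2 * (y + g ^ 2 + f)) ^ q := pow_le_pow_left₀ (by positivity) h1 q
      _ = 2 ^ q * (y + g ^ 2 + f) ^ q := mul_pow _ _ _
      _ ≤ 2 ^ q * (3 ^ q * (y ^ q + (g ^ 2) ^ q + f ^ q)) :=
        mul_le_mul_of_nonneg_left h2 (by positivity)
      _ = _ := by rw [← mul_assoc, ← mul_pow]; norm_num
  have hfin' := mul_le_mul_of_nonneg_left hfin (by positivity : 0 ≤ 2 * r ^ 3)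
  rw [hLHS, hSq, pow_mul, pow_mul, ← hy]
  have hlin : q * y ^ (q - 1) * (b + r ^ 2 * Z) = 2 * q * y ^ (q - 1) * inner ℝ x S +
      q * y ^ (q - 1) * ‖S‖ ^ 2 + 2 * q * f * r ^ 2 * y ^ (q - 1) := by
    rw [hb, hZ, hS]
    ring
  rw [hlin] at hT
  have hsq : q * (2 * q - 1) * y ^ (q - 1) * ‖S‖ ^ 2 = q * y ^ (q - 1) * ‖S‖ ^ 2 +
      2 * q * (q - 1) * y ^ (q - 1) * ‖S‖ ^ 2 := by ring
  rw [hsq, mul_assoc (2 * r ^ 3)]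
  linarith

/-- Young's inequality by cases, according to whether `y` exceeds `2 K`. -/
theorem mul_pow_pred_le {K y : ℝ} (hK : 0 ≤ K) (hy : 0 ≤ y) {q : ℕ} (hq : 1 ≤ q) :
    K * y ^ (q - 1) ≤ 1 / 2 * y ^ q + K * (2 * K) ^ (q - 1) := by
  obtain ⟨n, rfl⟩ : ∃ n, q = n + 1 := ⟨q - 1, by omega⟩
  rw [Nat.add_sub_cancel]
  rcases le_total y (2 * K) with h | h
  · have := mul_le_mul_of_nonneg_left (pow_le_pow_left₀ hy h n) hK
    have h2 : 0 ≤ y ^ (n + 1) := by positivity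
    linarith
  · have h1 := mul_le_mul_of_nonneg_right h (pow_nonneg hy n)
    have h2 : 0 ≤ K * (2 * K) ^ n := by positivity
    rw [pow_succ]
    linarith

theorem integral_const_add_add_add {Ω : Type*} {mΩ : MeasurableSpace Ω} {P : Measure Ω}
    [IsProbabilityMeasure P] {f g k : Ω → ℝ} (hf : Integrable f P) (hg : Integrable g P)
    (hk : Integrable k P) (c₀ c₁ c₂ c₃ : ℝ) :
    Integrable (fun ω => c₀ + c₁ * f ω + c₂ * g ω + c₃ * k ω) P ∧
      ∫ ω, (c₀ + c₁ * f ω + c₂ * g ω + c₃ * k ω) ∂P =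
        c₀ + c₁ * (∫ ω, f ω ∂P) + c₂ * (∫ ω, g ω ∂P) + c₃ * ∫ ω, k ω ∂P := by
  have I1 : Integrable (fun ω => c₀ + c₁ * f ω) P := (integrable_const _).add (hf.const_mul _)
  have I2 : Integrable (fun ω => c₀ + c₁ * f ω + c₂ * g ω) P := I1.add (hg.const_mul _)
  refine ⟨I2.add (hk.const_mul _), ?_⟩
  rw [integral_add I2 (hk.const_mul _), integral_add I1 (hg.const_mul _),
    integral_add (integrable_const _) (hf.const_mul _), integral_const_mul, integral_const_mul,
    integral_const_mul]
  simp

/-- Moments grow at most by the factor `1 + (1 + 2q(2q-1)a²) h` when a Gaussian sum of variance at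
most `2 a² (1 + ‖x‖²) h` is added to `x`. -/
theorem exists_lintegral_norm_add_pow_le {q : ℕ} (hq : 1 ≤ q) {a f : ℝ} (hf : 0 ≤ f) :
    ∃ K : ℝ, 0 ≤ K ∧ ∃ δ : ℝ, 0 < δ ∧
      ∀ {Ω : Type*} {_ : MeasurableSpace Ω} {P : Measure Ω} [IsProbabilityMeasure P]
        {V : Type*} [NormedAddCommGroup V] [InnerProductSpace ℝ V]
        {h : ℝ≥0} {ξ : ℕ → Ω → ℝ} (_ : IsGaussianSeq P h ξ) (_ : 0 < h) (_ : (h : ℝ) < δ)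
        (x : V) (b : ℕ → V) (J : Finset ℕ) (_ : ∑ j ∈ J, ‖b j‖ ^ 2 ≤ 2 * a ^ 2 * (1 + ‖x‖ ^ 2)),
        ∫⁻ ω, ENNReal.ofReal ((‖x + ∑ j ∈ J, ξ j ω • b j‖ ^ 2 + 2 * f * h) ^ q) ∂P ≤
          ENNReal.ofReal ((1 + (1 + 2 * q * (2 * q - 1) * a ^ 2) * h) * ‖x‖ ^ (2 * q) + K * h) := by
  set M := stdMoment q with hM
  have hM0 : 0 ≤ M := stdMoment_nonneg q
  have hq1 : (1 : ℝ) ≤ q := by exact_mod_cast hq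
  have hq2 : (0 : ℝ) ≤ 2 * q - 1 := by linarith
  -- The expected `O(r³)` remainder is at most `h (r K₁)(1 + ‖x‖^{2q})`; `δ` is chosen so that `r K₁
  -- ≤ 1/2`.
  set K₁ : ℝ := 2 * 6 ^ q * (1 + M * (4 * a ^ 2) ^ q + f ^ q) with hK₁
  have hK₁0 : 0 < K₁ := by positivity
  -- Coefficient of `h ‖x‖^{2(q-1)}`. Absorbing this lower power costs the rate the other `1/2`,
  -- whence the summand `1` in it.
  set K₂ : ℝ := 2 * q * (2 * q - 1) * a ^ 2 + 2 * q * f with hK₂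
  have hK₂0 : 0 ≤ K₂ := by positivity
  refine ⟨K₂ * (2 * K₂) ^ (q - 1) + 1 / 2, by positivity, (min 1 (1 / (2 * K₁))) ^ 2,
    by positivity, ?_⟩
  intro Ω mΩ P _ V _ _ h ξ hξ hh hδ x b J hb
  set r : ℝ := Real.sqrt h with hr
  have hh' : (0 : ℝ) < h := by exact_mod_cast hh
  have hr0 : 0 < r := Real.sqrt_pos.2 hh'
  have hrsq : r ^ 2 = h := Real.sq_sqrt hh'.le
  have hrmin : r < min 1 (1 / (2 * K₁)) := lt_of_pow_lt_pow_left₀ 2 (by positivity) (hrsq ▸ hδ)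
  have hr1 : r ≤ 1 := (hrmin.trans_le (min_le_left _ _)).le
  have hrK : r * K₁ ≤ 1 / 2 := by
    have h1 := (hrmin.trans_le (min_le_right _ _)).le
    rw [le_div_iff₀ (by positivity)] at h1
    linarith
  set S : Ω → V := fun ω => ∑ j ∈ J, ξ j ω • b j with hS
  set y : ℝ := ‖x‖ ^ 2 with hy
  have hy0 : 0 ≤ y := by positivity
  have hb0 : 0 ≤ ∑ j ∈ J, ‖b j‖ ^ 2 := by positivity
  obtain ⟨i1, e1⟩ := hξ.integral_inner_sum b J x
  obtain ⟨i2, e2⟩ := hξ.norm_sum_pow b J le_rfl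
  obtain ⟨i3, e3⟩ := hξ.norm_sum_pow b J hq
  simp only [mul_one, pow_one, stdMoment_one, one_mul] at i2 e2
  obtain ⟨hRint, hRval⟩ := integral_const_add_add_add i1 i2 i3
    (y ^ q + 2 * q * f * h * y ^ (q - 1) + 2 * r ^ 3 * 6 ^ q * (y ^ q + f ^ q))
    (2 * q * y ^ (q - 1)) (q * (2 * q - 1) * y ^ (q - 1)) (2 * r ^ 3 * 6 ^ q / h ^ q)
  set R : Ω → ℝ := fun ω =>
    (y ^ q + 2 * q * f * h * y ^ (q - 1) + 2 * r ^ 3 * 6 ^ q * (y ^ q + f ^ q)) +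
      2 * q * y ^ (q - 1) * inner ℝ x (S ω) + q * (2 * q - 1) * y ^ (q - 1) * ‖S ω‖ ^ 2 +
      2 * r ^ 3 * 6 ^ q / h ^ q * ‖S ω‖ ^ (2 * q) with hR
  have hle : ∀ ω, (‖x + S ω‖ ^ 2 + 2 * f * h) ^ q ≤ R ω := by
    intro ω
    have := norm_add_sq_add_pow_le hf hr0 hr1 hq x (S ω)
    rw [hrsq, pow_mul ‖x‖, pow_mul ‖x‖] at this
    refine this.trans (le_of_eq ?_)
    rw [hR]
    ring
  have hRnn : ∀ ω, 0 ≤ R ω := fun ω => le_trans (by positivity) (hle ω)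
  have hRval' : ∫ ω, R ω ∂P = y ^ q + q * (2 * q - 1) * y ^ (q - 1) * (∫ ω, ‖S ω‖ ^ 2 ∂P)
      + 2 * q * f * h * y ^ (q - 1)
      + 2 * r ^ 3 * 6 ^ q * (y ^ q + (∫ ω, ‖S ω‖ ^ (2 * q) ∂P) / h ^ q + f ^ q) := by
    rw [hRval, e1]
    ring
  have hfinal : ∫ ω, R ω ∂P ≤ (1 + (1 + 2 * q * (2 * q - 1) * a ^ 2) * h) * ‖x‖ ^ (2 * q) +
      (K₂ * (2 * K₂) ^ (q - 1) + 1 / 2) * h := by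
    rw [hRval', pow_mul, ← hy]
    have hyq : 0 ≤ y ^ q := by positivity
    have h1 : ∫ ω, ‖S ω‖ ^ 2 ∂P ≤ h * (2 * a ^ 2 * (1 + y)) :=
      e2.trans (mul_le_mul_of_nonneg_left hb hh'.le)
    have h2 : (∫ ω, ‖S ω‖ ^ (2 * q) ∂P) / h ^ q ≤ M * (4 * a ^ 2) ^ q * (1 + y ^ q) := by
      rw [div_le_iff₀ (by positivity)]
      refine e3.trans ?_
      rw [mul_pow, ← hM]
      have h3 : (∑ j ∈ J, ‖b j‖ ^ 2) ^ q ≤ (4 * a ^ 2) ^ q * (1 + y ^ q) := by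
        calc (∑ j ∈ J, ‖b j‖ ^ 2) ^ q ≤ (2 * a ^ 2 * (1 + y)) ^ q := pow_le_pow_left₀ hb0 hb q
          _ = (2 * a ^ 2) ^ q * (1 + y) ^ q := mul_pow _ _ _
          _ ≤ (2 * a ^ 2) ^ q * (2 ^ q * (1 + y ^ q)) := by
            refine mul_le_mul_of_nonneg_left ?_ (by positivity)
            have := add_pow_le (zero_le_one (α := ℝ)) hy0 q
            rw [one_pow] at this
            refine this.trans (mul_le_mul_of_nonneg_right ?_ (by positivity))
            exact pow_le_pow_right₀ one_le_two (Nat.sub_le _ _)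
          _ = _ := by rw [← mul_assoc, ← mul_pow]; ring
      calc M * ((h : ℝ) ^ q * (∑ j ∈ J, ‖b j‖ ^ 2) ^ q)
          ≤ M * ((h : ℝ) ^ q * ((4 * a ^ 2) ^ q * (1 + y ^ q))) := by gcongr
        _ = _ := by ring
    have h4 : 2 * r ^ 3 * 6 ^ q * (y ^ q + (∫ ω, ‖S ω‖ ^ (2 * q) ∂P) / h ^ q + f ^ q) ≤
        h * (1 / 2 * (1 + y ^ q)) := by
      have hfq : 0 ≤ f ^ q := by positivity
      have hMq : 0 ≤ M * (4 * a ^ 2) ^ q := by positivity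
      calc _ ≤ 2 * r ^ 3 * 6 ^ q * ((1 + M * (4 * a ^ 2) ^ q + f ^ q) * (1 + y ^ q)) := by
            refine mul_le_mul_of_nonneg_left ?_ (by positivity)
            nlinarith [mul_nonneg hfq hyq]
        _ = h * ((r * K₁) * (1 + y ^ q)) := by rw [hK₁, ← hrsq]; ring
        _ ≤ _ := by gcongr
    have h5 : q * (2 * q - 1) * y ^ (q - 1) * (∫ ω, ‖S ω‖ ^ 2 ∂P) ≤
        q * (2 * q - 1) * y ^ (q - 1) * (h * (2 * a ^ 2 * (1 + y))) :=
      mul_le_mul_of_nonneg_left h1 (by positivity)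
    have h6 : y ^ q = y ^ (q - 1) * y := by rw [← pow_succ, Nat.sub_add_cancel hq]
    have h7 := mul_le_mul_of_nonneg_left (mul_pow_pred_le hK₂0 hy0 hq) hh'.le
    have h8 : q * (2 * q - 1) * y ^ (q - 1) * (h * (2 * a ^ 2 * (1 + y))) =
        h * (2 * q * (2 * q - 1) * a ^ 2 * y ^ (q - 1)) +
          h * (2 * q * (2 * q - 1) * a ^ 2 * y ^ q) := by
      rw [h6]; ring
    have h9 : h * (K₂ * y ^ (q - 1)) = h * (2 * q * (2 * q - 1) * a ^ 2 * y ^ (q - 1)) +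
        2 * q * f * h * y ^ (q - 1) := by rw [hK₂]; ring
    rw [h8] at h5
    rw [h9] at h7
    linarith
  calc _ ≤ ∫⁻ ω, ENNReal.ofReal (R ω) ∂P :=
        lintegral_mono fun ω => ENNReal.ofReal_le_ofReal (hle ω)
    _ = ENNReal.ofReal (∫ ω, R ω ∂P) :=
        (ofReal_integral_eq_lintegral_ofReal hRint (Eventually.of_forall hRnn)).symm
    _ ≤ _ := ENNReal.ofReal_le_ofReal hfinal

/-- The constant `R̃_q` dominates the growth rate of the moments. -/
theorem one_add_le_Rtilde {q : ℕ} (hq : 1 ≤ q) {a : ℝ} (ha : 0 ≤ a) :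
    1 + 4 * q * (2 * q - 1) * a ^ 2 ≤ Rtilde q a := by
  have hq1 : (1 : ℝ) ≤ q := by exact_mod_cast hq
  have hR0 : 0 ≤ R (2 * q) := Real.sqrt_nonneg _
  -- For `p = 2q` the factor `p(p-1)/2` is `q(2q-1)`, and the other factor is at least `1`.
  have hR2 : (2 * q - 1 : ℝ) ≤ R (2 * q) ^ 2 := by
    have h1 : (1 : ℝ) ≤ ((2 * q : ℕ) : ℝ) / (((2 * q : ℕ) : ℝ) - 1) := by
      push_cast
      rw [le_div_iff₀ (by linarith)]
      linarith
    have h2 : (2 * q - 1 : ℝ) ≤ ((2 * q : ℕ) : ℝ) * (((2 * q : ℕ) : ℝ) - 1) / 2 := by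
      push_cast
      nlinarith
    have h3 : (0 : ℝ) ≤ ((2 * q : ℕ) : ℝ) * (((2 * q : ℕ) : ℝ) - 1) / 2 := by linarith
    have h4 := one_le_pow₀ h1 (n := 2 * q - 2)
    rw [R, Real.sq_sqrt (mul_nonneg h3 (zero_le_one.trans h4))]
    exact h2.trans (le_mul_of_one_le_right h3 h4)
  have hfirst : 1 ≤ (1 + 4 * a * R (2 * q)) ^ q :=
    one_le_pow₀ (le_add_of_nonneg_right (by positivity))
  -- The single term `i₁ = q - 1`, `i₂ = 0` equals `4 q R² a²` and suffices; all other terms are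
  -- nonnegative.
  have hterm : (4 : ℝ) * q * (2 * q - 1) * a ^ 2 ≤
      (q.choose (q - 1) : ℝ) * ((q - (q - 1)).choose 0 : ℝ) *
        2 ^ (3 * q - 3 * (q - 1) - 0 - 1) * R (2 * q) ^ (2 * q - 2 * (q - 1) - 0) *
        a ^ (2 * q - 2 * (q - 1) - 0) := by
    have e1 : 3 * q - 3 * (q - 1) - 0 - 1 = 2 := by omega
    have e2 : 2 * q - 2 * (q - 1) - 0 = 2 := by omega
    have e3 : q.choose (q - 1) = q := by
      rw [Nat.choose_symm_of_eq_add (show q = (q - 1) + 1 by omega), Nat.choose_one_right]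
    rw [e1, e2, e3, Nat.choose_zero_right, Nat.cast_one, mul_one]
    have := mul_le_mul_of_nonneg_left hR2 (by positivity : (0 : ℝ) ≤ 4 * q * a ^ 2)
    linarith
  have hnn : ∀ i₁ i₂ : ℕ, 0 ≤ (q.choose i₁ : ℝ) * ((q - i₁).choose i₂ : ℝ) *
      2 ^ (3 * q - 3 * i₁ - i₂ - 1) * R (2 * q) ^ (2 * q - 2 * i₁ - i₂) *
      a ^ (2 * q - 2 * i₁ - i₂) := fun i₁ i₂ => by positivity
  refine add_le_add hfirst (hterm.trans (le_trans ?_ (Finset.single_le_sum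
    (f := fun i₁ => ∑ i₂ ∈ Finset.range (q - i₁), (q.choose i₁ : ℝ) * ((q - i₁).choose i₂ : ℝ) *
      2 ^ (3 * q - 3 * i₁ - i₂ - 1) * R (2 * q) ^ (2 * q - 2 * i₁ - i₂) *
      a ^ (2 * q - 2 * i₁ - i₂)) (fun i _ => Finset.sum_nonneg fun j _ => hnn i j)
    (Finset.mem_range.2 (by omega : q - 1 < q)))))
  exact Finset.single_le_sum
    (f := fun i₂ => (q.choose (q - 1) : ℝ) * ((q - (q - 1)).choose i₂ : ℝ) *
      2 ^ (3 * q - 3 * (q - 1) - i₂ - 1) * R (2 * q) ^ (2 * q - 2 * (q - 1) - i₂) *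
      a ^ (2 * q - 2 * (q - 1) - i₂)) (fun j _ => hnn (q - 1) j)
    (Finset.mem_range.2 (by omega : 0 < q - (q - 1)))

end OneStep

/-! ## Gaussian noise with random coefficients independent of it -/

section Noise

variable {Ω : Type*} {m m' mΩ : MeasurableSpace Ω} {P : Measure Ω}

/-- Fatou's lemma for sequences converging in measure. -/
theorem lintegral_le_of_tendstoInMeasure {V : Type*} [NormedAddCommGroup V] {X : ℕ → Ω → V} {N : Ω → V} {f : Ω → V → ℝ≥0∞} {c : ℝ≥0∞}
    (hX : TendstoInMeasure P X atTop N) (hf : ∀ ω, Continuous (f ω))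
    (hm : ∀ n, AEMeasurable (fun ω => f ω (X n ω)) P)
    (hle : ∀ n, ∫⁻ ω, f ω (X n ω) ∂P ≤ c) : ∫⁻ ω, f ω (N ω) ∂P ≤ c := by
  obtain ⟨ns, -, hlim⟩ := hX.exists_seq_tendsto_ae
  calc ∫⁻ ω, f ω (N ω) ∂P = ∫⁻ ω, liminf (fun i => f ω (X (ns i) ω)) atTop ∂P := by
        refine lintegral_congr_ae ?_
        filter_upwards [hlim] with ω hω
        exact (((hf ω).tendsto _).comp hω).liminf_eq.symm
    _ ≤ liminf (fun i => ∫⁻ ω, f ω (X (ns i) ω) ∂P) atTop :=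
        lintegral_liminf_le' fun i => hm (ns i)
    _ ≤ liminf (fun _ : ℕ => c) atTop := liminf_le_liminf (Eventually.of_forall fun i => hle (ns i))
    _ = c := liminf_const c

variable [IsProbabilityMeasure P]

/-- Freezing: by independence the joint law is a product, and Tonelli applies. -/
theorem lintegral_comp_of_indep {V T : Type*} {mV : MeasurableSpace V} {mT : MeasurableSpace T}
    (hm : m ≤ mΩ) {U : Ω → V} {ξ : Ω → T} (hU : Measurable[m] U) (hξ : Measurable ξ)
    (hind : Indep (MeasurableSpace.comap ξ mT) m P) {f : V × T → ℝ≥0∞} (hf : Measurable f) :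
    ∫⁻ ω, f (U ω, ξ ω) ∂P = ∫⁻ ω, ∫⁻ ω', f (U ω, ξ ω') ∂P ∂P := by
  have hUm : Measurable U := hU.mono hm le_rfl
  have hi : IndepFun U ξ P := by
    rw [IndepFun_iff_Indep]
    exact indep_of_indep_of_le_left hind.symm hU.comap_le
  have hmap := (indepFun_iff_map_prod_eq_prod_map_map hUm.aemeasurable hξ.aemeasurable).1 hi
  have : IsProbabilityMeasure (P.map ξ) := Measure.isProbabilityMeasure_map hξ.aemeasurable
  calc ∫⁻ ω, f (U ω, ξ ω) ∂P = ∫⁻ z, f z ∂(P.map fun ω => (U ω, ξ ω)) :=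
        (lintegral_map hf (hUm.prodMk hξ)).symm
    _ = ∫⁻ x, ∫⁻ t, f (x, t) ∂(P.map ξ) ∂(P.map U) := by
        rw [hmap, lintegral_prod _ hf.aemeasurable]
    _ = ∫⁻ ω, ∫⁻ t, f (U ω, t) ∂(P.map ξ) ∂P := lintegral_map hf.lintegral_prod_right' hUm
    _ = _ := by
        refine lintegral_congr fun ω => ?_
        exact lintegral_map (hf.comp measurable_prodMk_left) hξ

variable {V : Type*} [NormedAddCommGroup V] [InnerProductSpace ℝ V] [SecondCountableTopology V]
  {h : ℝ≥0} {ξ : ℕ → Ω → ℝ} {Φ : V → ℕ → V} {U : Ω → V}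

theorem lintegral_comp_sum_of_indep (hm : m ≤ mΩ) (hξ : IsGaussianSeq P h ξ)
    (hind : Indep (MeasurableSpace.comap (fun ω j => ξ j ω) MeasurableSpace.pi) m P)
    (hU : StronglyMeasurable[m] U) (hΦ : ∀ j, Continuous fun x => Φ x j) (J : Finset ℕ)
    {f : V → V → ℝ≥0∞} (hf : Continuous fun z : V × V => f z.1 z.2) :
    ∫⁻ ω, f (U ω) (∑ j ∈ J, ξ j ω • Φ (U ω) j) ∂P =
      ∫⁻ ω, ∫⁻ ω', f (U ω) (∑ j ∈ J, ξ j ω' • Φ (U ω) j) ∂P ∂P := by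
  borelize V
  refine lintegral_comp_of_indep (T := ℕ → ℝ) (f := fun z => f z.1 (∑ j ∈ J, z.2 j • Φ z.1 j)) hm
    hU.measurable (measurable_pi_lambda _ hξ.measurable) hind ?_
  refine hf.measurable.comp (measurable_fst.prodMk (Finset.measurable_fun_sum J fun j _ => ?_))
  exact ((measurable_pi_apply j).comp measurable_snd).smul ((hΦ j).measurable.comp measurable_fst)

/-- The upper half of the Itô isometry, obtained by freezing `U`. -/
theorem lintegral_enorm_sum_sq_le (hm : m ≤ mΩ) (hξ : IsGaussianSeq P h ξ)
    (hind : Indep (MeasurableSpace.comap (fun ω j => ξ j ω) MeasurableSpace.pi) m P)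
    (hU : StronglyMeasurable[m] U) (hΦ : ∀ j, Continuous fun x => Φ x j) (J : Finset ℕ) :
    ∫⁻ ω, ‖∑ j ∈ J, ξ j ω • Φ (U ω) j‖ₑ ^ 2 ∂P ≤ h * ∑ j ∈ J, ∫⁻ ω, ‖Φ (U ω) j‖ₑ ^ 2 ∂P := by
  have hUm := (hU.mono hm)
  rw [lintegral_comp_sum_of_indep (f := fun _ y => ‖y‖ₑ ^ 2) hm hξ hind hU hΦ J (by fun_prop),
    ← lintegral_finsetSum' _ fun j _ =>
      ((((hΦ j).comp_stronglyMeasurable hUm).enorm).pow_const 2).aemeasurable,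
    ← lintegral_const_mul' _ _ ENNReal.coe_ne_top]
  refine lintegral_mono fun ω => ?_
  obtain ⟨i, e⟩ := hξ.norm_sum_pow (Φ (U ω)) J le_rfl
  simp only [mul_one, pow_one, stdMoment_one, one_mul] at i e
  have h1 : ∀ v : V, ‖v‖ₑ ^ 2 = ENNReal.ofReal (‖v‖ ^ 2) := fun v => by
    rw [ENNReal.ofReal_pow (norm_nonneg _), ofReal_norm]
  simp only [h1]
  rw [← ofReal_integral_eq_lintegral_ofReal i (Eventually.of_forall fun _ => sq_nonneg _),
    ← ENNReal.ofReal_sum_of_nonneg fun _ _ => sq_nonneg _, ← ENNReal.ofReal_coe_nnreal,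
    ← ENNReal.ofReal_mul h.coe_nonneg]
  exact ENNReal.ofReal_le_ofReal e

/-- If the coefficients are square summable in mean, the noise series converges in measure. -/
theorem exists_tendstoInMeasure_of_tsum_ne_top [CompleteSpace V] (hm : m ≤ mΩ)
    (hξ : IsGaussianSeq P h ξ)
    (hind : Indep (MeasurableSpace.comap (fun ω j => ξ j ω) MeasurableSpace.pi) m P)
    (hU : StronglyMeasurable[m] U) (hΦ : ∀ j, Continuous fun x => Φ x j)
    (hsum : ∑' j, ∫⁻ ω, ‖Φ (U ω) j‖ₑ ^ 2 ∂P ≠ ∞) :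
    ∃ N : Ω → V, TendstoInMeasure P
      (fun n ω => ∑ j ∈ Finset.range n, ξ j ω • Φ (U ω) j) atTop N := by
  have hUm := (hU.mono hm)
  set t : ℕ → ℝ≥0∞ := fun j => ∫⁻ ω, ‖Φ (U ω) j‖ₑ ^ 2 ∂P with ht
  set S : Finset ℕ → Ω → V := fun J ω => ∑ j ∈ J, ξ j ω • Φ (U ω) j with hS
  have hSm : ∀ J, StronglyMeasurable (S J) := fun J => Finset.stronglyMeasurable_fun_sum J
    fun j _ => (hξ.measurable j).stronglyMeasurable.smul ((hΦ j).comp_stronglyMeasurable hUm)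
  have hS2 : ∀ J, eLpNorm (S J) 2 P ≤ (h * ∑ j ∈ J, t j) ^ ((2 : ℝ)⁻¹) := by
    intro J
    have h1 := eLpNorm_nnreal_pow_eq_lintegral (μ := P) (f := S J) (p := 2) two_ne_zero
    simp only [NNReal.coe_ofNat, ENNReal.coe_ofNat, ENNReal.rpow_ofNat] at h1
    rw [ENNReal.le_rpow_inv_iff two_pos, ENNReal.rpow_ofNat, h1]
    exact lintegral_enorm_sum_sq_le hm hξ hind hU hΦ J
  have hSLp : ∀ J, MemLp (S J) 2 P := fun J => by
    refine ⟨(hSm J).aestronglyMeasurable, (hS2 J).trans_lt ?_⟩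
    refine ENNReal.rpow_lt_top_of_nonneg (by norm_num) (ENNReal.mul_ne_top ENNReal.coe_ne_top ?_)
    exact ne_top_of_le_ne_top hsum (ENNReal.sum_le_tsum J)
  set Y : ℕ → Lp V 2 P := fun n => (hSLp (Finset.range n)).toLp _ with hY
  have hdist : ∀ N i n, N ≤ i → i ≤ n →
      edist (Y n) (Y i) ≤ (h * ∑' k, t (k + N)) ^ ((2 : ℝ)⁻¹) := by
    intro N i n hNi hin
    rw [hY, Lp.edist_toLp_toLp]
    have h1 : S (Finset.range n) - S (Finset.range i) = S (Finset.Ico i n) := by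
      ext ω
      rw [Pi.sub_apply, hS]
      simp only
      rw [Finset.sum_Ico_eq_sub _ hin]
    rw [h1]
    refine (hS2 _).trans (ENNReal.rpow_le_rpow ?_ (by norm_num))
    gcongr
    calc ∑ j ∈ Finset.Ico i n, t j ≤ ∑ j ∈ Finset.Ico N n, t j :=
          Finset.sum_le_sum_of_subset (Finset.Ico_subset_Ico_left hNi)
      _ = ∑ k ∈ Finset.range (n - N), t (k + N) := by
          rw [Finset.sum_Ico_eq_sum_range]
          exact Finset.sum_congr rfl fun k _ => by rw [add_comm]
      _ ≤ _ := ENNReal.sum_le_tsum _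
  have hcau : CauchySeq Y := by
    refine EMetric.cauchySeq_iff_le_tendsto_0.2
      ⟨fun N => (h * ∑' k, t (k + N)) ^ ((2 : ℝ)⁻¹), fun n i N hn hi => ?_, ?_⟩
    · rcases le_total i n with hle | hle
      · exact hdist N i n hi hle
      · rw [edist_comm]
        exact hdist N n i hn hle
    · have h1 := ENNReal.Tendsto.const_mul (a := (h : ℝ≥0∞)) (ENNReal.tendsto_sum_nat_add t hsum)
        (Or.inr ENNReal.coe_ne_top)
      rw [mul_zero] at h1
      have h2 := h1.ennrpow_const (2⁻¹)
      rwa [ENNReal.zero_rpow_of_pos (by norm_num)] at h2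
  obtain ⟨N, hN⟩ := cauchySeq_tendsto_of_complete hcau
  exact ⟨N, (tendstoInMeasure_of_tendsto_Lp hN).congr_left fun n => (hSLp _).coeFn_toLp⟩

/-- Existence of the noise term. -/
theorem exists_noise [CompleteSpace V] (hm : m ≤ m') (hm' : m' ≤ mΩ) (hξ : IsGaussianSeq P h ξ)
    (hξm : ∀ j, Measurable[m'] (ξ j))
    (hind : Indep (MeasurableSpace.comap (fun ω j => ξ j ω) MeasurableSpace.pi) m P)
    (hU : StronglyMeasurable[m] U) (hΦ : ∀ j, Continuous fun x => Φ x j) {a : ℝ}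
    (hsum : ∀ x, ∑' j, ‖Φ x j‖ₑ ^ 2 ≤ ENNReal.ofReal (2 * a ^ 2 * (1 + ‖x‖ ^ 2))) :
    ∃ N : Ω → V, StronglyMeasurable[m'] N ∧ TendstoInMeasure P
      (fun n ω => ∑ j ∈ Finset.range n, ξ j ω • Φ (U ω) j) atTop N := by
  have hUm := (hU.mono (hm.trans hm'))
  -- `U` need not have moments. Damping by `ρ` bounds the sum of squares by `2 a²`, and the factor
  -- is restored after passing to the limit.
  set ρ : V → ℝ := fun x => (1 + ‖x‖)⁻¹ with hρ
  have hpos : ∀ x : V, 0 < 1 + ‖x‖ := fun x => by positivity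
  have hρc : Continuous ρ := Continuous.inv₀ (by fun_prop) fun x => (hpos x).ne'
  set X : ℕ → Ω → V := fun n ω => ∑ j ∈ Finset.range n, ξ j ω • Φ (U ω) j with hX
  have hXm : ∀ n, StronglyMeasurable[m'] (X n) := fun n => Finset.stronglyMeasurable_fun_sum _
    fun j _ => (hξm j).stronglyMeasurable.smul ((hΦ j).comp_stronglyMeasurable (hU.mono hm))
  have hXm0 : ∀ n, StronglyMeasurable (X n) := fun n => (hXm n).mono hm'
  obtain ⟨Y, hY⟩ := exists_tendstoInMeasure_of_tsum_ne_top (Φ := fun x j => ρ x • Φ x j)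
    (hm.trans hm') hξ hind hU (fun j => hρc.smul (hΦ j)) (by
      have h1 : ∀ j, AEMeasurable (fun ω => ‖ρ (U ω) • Φ (U ω) j‖ₑ ^ 2) P := fun j =>
        ((((hρc.smul (hΦ j)).comp_stronglyMeasurable hUm).enorm).pow_const 2).aemeasurable
      rw [← lintegral_tsum h1]
      refine ne_top_of_le_ne_top (b := ∫⁻ _, ENNReal.ofReal (2 * a ^ 2) ∂P)
        (by rw [lintegral_const, measure_univ, mul_one]; exact ENNReal.ofReal_ne_top)
        (lintegral_mono fun ω => ?_)
      simp only [enorm_smul, mul_pow]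
      rw [ENNReal.tsum_mul_left]
      refine (mul_le_mul_right (hsum (U ω)) _).trans ?_
      rw [Real.enorm_eq_ofReal (inv_nonneg.2 (hpos _).le), ← ENNReal.ofReal_pow
        (inv_nonneg.2 (hpos _).le), ← ENNReal.ofReal_mul (by positivity)]
      refine ENNReal.ofReal_le_ofReal ?_
      rw [inv_pow, inv_mul_le_iff₀ (by have := hpos (U ω); positivity)]
      nlinarith [norm_nonneg (U ω), sq_nonneg a, mul_nonneg (sq_nonneg a) (norm_nonneg (U ω))])
  have hYX : ∀ n ω, (1 + ‖U ω‖) • ∑ j ∈ Finset.range n, ξ j ω • ρ (U ω) • Φ (U ω) j = X n ω := by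
    intro n ω
    rw [hX, Finset.smul_sum]
    refine Finset.sum_congr rfl fun j _ => ?_
    rw [smul_comm (ξ j ω), hρ, smul_inv_smul₀ (hpos _).ne']
  have hN0 : TendstoInMeasure P X atTop fun ω => (1 + ‖U ω‖) • Y ω := by
    refine (exists_seq_tendstoInMeasure_atTop_iff fun n =>
      (hXm0 n).aestronglyMeasurable).2 fun ns hns => ?_
    obtain ⟨ns', hns', hlim⟩ := (hY.comp hns.tendsto_atTop).exists_seq_tendsto_ae
    refine ⟨ns', hns', ?_⟩
    filter_upwards [hlim] with ω hω
    exact (hω.const_smul (1 + ‖U ω‖)).congr fun i => hYX _ ω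
  obtain ⟨ns, -, hlim⟩ := hN0.exists_seq_tendsto_ae
  -- The pointwise limit along a subsequence is exactly `m'`-measurable, so the filtration need not
  -- be complete.
  refine ⟨fun ω => limUnder atTop fun i => X (ns i) ω,
    @StronglyMeasurable.limUnder ℕ Ω V m' _ _ atTop _ _ _ _ fun i => hXm (ns i), hN0.congr_right ?_⟩
  filter_upwards [hlim] with ω hω
  exact hω.limUnder_eq.symm

end Noise

/-! ## Hilbert–Schmidt bounds for the diffusion -/

section HilbertSchmidt

theorem enorm_sq_eq_ofReal {V : Type*} [NormedAddCommGroup V] (v : V) :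
    ‖v‖ₑ ^ 2 = ENNReal.ofReal (‖v‖ ^ 2) := by
  rw [ENNReal.ofReal_pow (norm_nonneg _), ofReal_norm]

variable {ι U V : Type*} [NormedAddCommGroup U] [InnerProductSpace ℝ U]
  [NormedAddCommGroup V] [InnerProductSpace ℝ V] (η : HilbertBasis ι ℝ U)

theorem hsNormSq_le_two_mul_add (T T' : U →L[ℝ] V) :
    hsNormSq η T ≤ 2 * (hsNormSq η (T - T') + hsNormSq η T') := by
  unfold hsNormSq
  rw [← ENNReal.tsum_add, ← ENNReal.tsum_mul_left]
  refine ENNReal.tsum_le_tsum fun j => ?_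
  rw [enorm_sq_eq_ofReal, enorm_sq_eq_ofReal, enorm_sq_eq_ofReal, ← ENNReal.ofReal_add
    (sq_nonneg _) (sq_nonneg _), ← ENNReal.ofReal_ofNat, ← ENNReal.ofReal_mul zero_le_two]
  refine ENNReal.ofReal_le_ofReal ?_
  have h1 : ‖T (η j)‖ ≤ ‖(T - T') (η j)‖ + ‖T' (η j)‖ := by
    rw [sub_apply]
    exact norm_le_norm_sub_add _ _
  calc ‖T (η j)‖ ^ 2 ≤ (‖(T - T') (η j)‖ + ‖T' (η j)‖) ^ 2 :=
        pow_le_pow_left₀ (norm_nonneg _) h1 2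
    _ ≤ _ := add_sq_le

theorem hsNormSq_neg (T : U →L[ℝ] V) : hsNormSq η (-T) = hsNormSq η T := by
  simp [hsNormSq]

theorem hsNormSq_sub_ne_top {T T' : U →L[ℝ] V} (h : hsNormSq η T ≠ ∞) (h' : hsNormSq η T' ≠ ∞) :
    hsNormSq η (T - T') ≠ ∞ := by
  refine ne_top_of_le_ne_top ?_ (hsNormSq_le_two_mul_add η (T - T') (-T'))
  rw [sub_neg_eq_add, sub_add_cancel, hsNormSq_neg]
  exact ENNReal.mul_ne_top (by simp) (ENNReal.add_ne_top.2 ⟨h, h'⟩)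

theorem hsNormSq_eq_ofReal {T : U →L[ℝ] V} (h : hsNormSq η T ≠ ∞) :
    hsNormSq η T = ENNReal.ofReal (hsNorm η T ^ 2) := by
  rw [hsNorm, Real.sq_sqrt ENNReal.toReal_nonneg, ENNReal.ofReal_toReal h]

variable {η} {B : V → (U →L[ℝ] V)} {α a : ℝ}

theorem hsNormSq_sub_le (hfin : ∀ x, hsNormSq η (B x) ≠ ∞)
    (hlip : ∀ u v, hsNorm η (B u - B v) ≤ α * ‖u - v‖) (hα : α ≤ a) (u v : V) :
    hsNormSq η (B u - B v) ≤ ENNReal.ofReal (a ^ 2 * ‖u - v‖ ^ 2) := by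
  rw [hsNormSq_eq_ofReal η (hsNormSq_sub_ne_top η (hfin u) (hfin v)), ← mul_pow]
  exact ENNReal.ofReal_le_ofReal (pow_le_pow_left₀ (Real.sqrt_nonneg _)
    ((hlip u v).trans (mul_le_mul_of_nonneg_right hα (norm_nonneg _))) 2)

theorem hsNormSq_le (hfin : ∀ x, hsNormSq η (B x) ≠ ∞)
    (hlip : ∀ u v, hsNorm η (B u - B v) ≤ α * ‖u - v‖) (hα : α ≤ a)
    (h0 : hsNorm η (B 0) ≤ a) (x : V) :
    hsNormSq η (B x) ≤ ENNReal.ofReal (2 * a ^ 2 * (1 + ‖x‖ ^ 2)) := by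
  have h1 := hsNormSq_sub_le hfin hlip hα x 0
  have h2 : hsNormSq η (B 0) ≤ ENNReal.ofReal (a ^ 2) := by
    rw [hsNormSq_eq_ofReal η (hfin 0)]
    exact ENNReal.ofReal_le_ofReal (pow_le_pow_left₀ (Real.sqrt_nonneg _) h0 2)
  rw [sub_zero] at h1
  calc hsNormSq η (B x) ≤ 2 * (hsNormSq η (B x - B 0) + hsNormSq η (B 0)) :=
        hsNormSq_le_two_mul_add η _ _
    _ ≤ 2 * (ENNReal.ofReal (a ^ 2 * ‖x‖ ^ 2) + ENNReal.ofReal (a ^ 2)) := by gcongr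
    _ = _ := by
        rw [← ENNReal.ofReal_add (by positivity) (by positivity), ← ENNReal.ofReal_ofNat,
          ← ENNReal.ofReal_mul zero_le_two]
        congr 1
        ring

theorem continuous_apply_of_hsNorm_sub_le (hfin : ∀ x, hsNormSq η (B x) ≠ ∞)
    (hlip : ∀ u v, hsNorm η (B u - B v) ≤ α * ‖u - v‖) (j : ι) :
    Continuous fun x => B x (η j) := by
  refine LipschitzWith.continuous (K := ‖α‖₊) (LipschitzWith.of_dist_le_mul fun u v => ?_)
  have h1 := (ENNReal.le_tsum (f := fun j => ‖(B u - B v) (η j)‖ₑ ^ 2) j).trans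
    (hsNormSq_sub_le hfin hlip (le_abs_self α) u v)
  rw [enorm_sq_eq_ofReal, ENNReal.ofReal_le_ofReal_iff (by positivity), ← mul_pow] at h1
  rw [dist_eq_norm, dist_eq_norm]
  exact le_of_sq_le_sq h1 (by positivity)

end HilbertSchmidt

/-! ## Moment bounds -/

section Moments

/-- The one-step estimate is uniform in the number of summands: it is applied to partial sums with
`U` frozen, and Fatou's lemma passes to the series. -/
theorem exists_lintegral_noise_le {q : ℕ} (hq : 1 ≤ q) {a f : ℝ} (hf : 0 ≤ f) :
    ∃ K : ℝ, 0 ≤ K ∧ ∃ δ : ℝ, 0 < δ ∧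
      ∀ {Ω : Type*} {m mΩ : MeasurableSpace Ω} {P : Measure Ω} [IsProbabilityMeasure P]
        {V : Type*} [NormedAddCommGroup V] [InnerProductSpace ℝ V] [SecondCountableTopology V]
        {h : ℝ≥0} {ξ : ℕ → Ω → ℝ} {Φ : V → ℕ → V} {U N : Ω → V} (_ : m ≤ mΩ)
        (_ : IsGaussianSeq P h ξ) (_ : 0 < h) (_ : (h : ℝ) < δ)
        (_ : Indep (MeasurableSpace.comap (fun ω j => ξ j ω) MeasurableSpace.pi) m P)
        (_ : StronglyMeasurable[m] U) (_ : ∀ j, Continuous fun x => Φ x j)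
        (_ : ∀ x, ∑' j, ‖Φ x j‖ₑ ^ 2 ≤ ENNReal.ofReal (2 * a ^ 2 * (1 + ‖x‖ ^ 2)))
        (_ : TendstoInMeasure P (fun n ω => ∑ j ∈ Finset.range n, ξ j ω • Φ (U ω) j) atTop N),
        ∫⁻ ω, ENNReal.ofReal ((‖U ω + N ω‖ ^ 2 + 2 * f * h) ^ q) ∂P ≤
          ENNReal.ofReal (1 + (1 + 2 * q * (2 * q - 1) * a ^ 2) * h) *
            ∫⁻ ω, ‖U ω‖ₑ ^ (2 * q) ∂P + ENNReal.ofReal (K * h) := by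
  obtain ⟨K, hK, δ, hδ, H⟩ := exists_lintegral_norm_add_pow_le hq (a := a) hf
  refine ⟨K, hK, δ, hδ, ?_⟩
  intro Ω m mΩ P _ V _ _ _ h ξ Φ U N hm hξ hh hhδ hind hU hΦ hsum hN
  have hUm := hU.mono hm
  have hq1 : (1 : ℝ) ≤ q := by exact_mod_cast hq
  have hc : 0 ≤ 1 + (1 + 2 * q * (2 * q - 1) * a ^ 2) * (h : ℝ) := by
    have : (0 : ℝ) ≤ 2 * q - 1 := by linarith
    positivity
  refine lintegral_le_of_tendstoInMeasure
    (f := fun ω v => ENNReal.ofReal ((‖U ω + v‖ ^ 2 + 2 * f * h) ^ q)) hN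
    (fun ω => ENNReal.continuous_ofReal.comp (by fun_prop)) (fun n => ?_) (fun n => ?_)
  · refine (ENNReal.measurable_ofReal.comp ?_).aemeasurable
    have hS : StronglyMeasurable fun ω => ∑ j ∈ Finset.range n, ξ j ω • Φ (U ω) j :=
      Finset.stronglyMeasurable_fun_sum _ fun j _ =>
        (hξ.measurable j).stronglyMeasurable.smul ((hΦ j).comp_stronglyMeasurable hUm)
    exact ((((hUm.add hS).norm.measurable).pow_const 2).add_const _).pow_const q
  · rw [lintegral_comp_sum_of_indep
      (f := fun x y => ENNReal.ofReal ((‖x + y‖ ^ 2 + 2 * f * h) ^ q)) hm hξ hind hU hΦ _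
      (ENNReal.continuous_ofReal.comp (by fun_prop))]
    calc _ ≤ ∫⁻ ω, (ENNReal.ofReal (1 + (1 + 2 * q * (2 * q - 1) * a ^ 2) * h) *
          ‖U ω‖ₑ ^ (2 * q) + ENNReal.ofReal (K * h)) ∂P := by
          refine lintegral_mono fun ω => ?_
          have h1 : ∑ j ∈ Finset.range n, ‖Φ (U ω) j‖ ^ 2 ≤ 2 * a ^ 2 * (1 + ‖U ω‖ ^ 2) := by
            have := (ENNReal.sum_le_tsum (Finset.range n)).trans (hsum (U ω))
            simp only [enorm_sq_eq_ofReal] at this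
            rwa [← ENNReal.ofReal_sum_of_nonneg fun _ _ => sq_nonneg _,
              ENNReal.ofReal_le_ofReal_iff (by positivity)] at this
          refine (H hξ hh hhδ (U ω) (Φ (U ω)) (Finset.range n) h1).trans (le_of_eq ?_)
          rw [ENNReal.ofReal_add (mul_nonneg hc (by positivity)) (by positivity),
            ENNReal.ofReal_mul hc, ENNReal.ofReal_pow (norm_nonneg _), ofReal_norm]
      _ = _ := by
          rw [lintegral_add_right _ measurable_const, lintegral_const_mul' _ _ ENNReal.ofReal_ne_top,
            lintegral_const, measure_univ, mul_one]

variable {Θ : Set E3} {F : Fields Θ → Fields Θ} {α σ f h : ℝ}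

/-- Comparison with `0` and Young's inequality for `⟨u, F 0⟩`; this is the origin of `α̃_F`. -/
theorem inner_apply_le {H : Type*} [NormedAddCommGroup H] [InnerProductSpace ℝ H] {F : H → H}
    {α f : ℝ} (hmono : ∀ u v, inner ℝ (u - v) (F u - F v) ≤ α * ‖u - v‖ ^ 2)
    (hf : f = 1 / 2 * max (1 + 2 * α) (‖F 0‖ ^ 2)) (u : H) :
    inner ℝ u (F u) ≤ f * (‖u‖ ^ 2 + 1) := by
  have h1 := hmono u 0
  rw [sub_zero, inner_sub_right] at h1
  have h2 := real_inner_le_norm u (F 0)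
  have h3 := two_mul_le_add_sq ‖u‖ ‖F 0‖
  have h4 : 1 + 2 * α ≤ 2 * f := by rw [hf]; linarith [le_max_left (1 + 2 * α) (‖F 0‖ ^ 2)]
  have h5 : ‖F 0‖ ^ 2 ≤ 2 * f := by rw [hf]; linarith [le_max_right (1 + 2 * α) (‖F 0‖ ^ 2)]
  have h6 := mul_le_mul_of_nonneg_right h4 (sq_nonneg ‖u‖)
  linarith

theorem IsStep.norm_sq_le (hF : ∀ u, inner ℝ u (F u) ≤ f * (‖u‖ ^ 2 + 1)) (hh : 0 ≤ h)
    {g u : Fields Θ} (hu : IsStep F σ h g u) :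
    (1 + 2 * (σ - f) * h) * ‖u‖ ^ 2 ≤ ‖g‖ ^ 2 + 2 * f * h := by
  obtain ⟨w, hw, e⟩ := hu
  have h1 := congrArg (inner ℝ u) e
  rw [inner_add_right, inner_sub_right, inner_sub_right, real_inner_smul_right,
    real_inner_smul_right, real_inner_smul_right, isSkewAdjointRel_isMaxwell.inner_eq_zero hw,
    real_inner_self_eq_norm_sq] at h1
  have h2 := real_inner_le_norm u g
  have h3 := two_mul_le_add_sq ‖u‖ ‖g‖
  have h4 := mul_le_mul_of_nonneg_left (hF u) hh
  linarith

/-- Bernoulli's inequality linearises the `q`-th power of the damping factor. -/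
theorem lintegral_norm_pow_le_of_isStep {Ω : Type*} {mΩ : MeasurableSpace Ω} {P : Measure Ω}
    (hF : ∀ u, inner ℝ u (F u) ≤ f * (‖u‖ ^ 2 + 1)) (hh : 0 ≤ h) (hσ : f ≤ σ)
    {g u : Ω → Fields Θ} (hu : ∀ᵐ ω ∂P, IsStep F σ h (g ω) (u ω)) (q : ℕ) :
    ENNReal.ofReal (1 + q * (2 * (σ - f) * h)) * ∫⁻ ω, ‖u ω‖ₑ ^ (2 * q) ∂P ≤
      ∫⁻ ω, ENNReal.ofReal ((‖g ω‖ ^ 2 + 2 * f * h) ^ q) ∂P := by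
  have hA : 0 ≤ 2 * (σ - f) * h := mul_nonneg (mul_nonneg zero_le_two (sub_nonneg.2 hσ)) hh
  rw [← lintegral_const_mul' _ _ ENNReal.ofReal_ne_top]
  refine lintegral_mono_ae ?_
  filter_upwards [hu] with ω hω
  rw [← ofReal_norm, ← ENNReal.ofReal_pow (norm_nonneg _), ← ENNReal.ofReal_mul (by positivity)]
  refine ENNReal.ofReal_le_ofReal ?_
  calc (1 + q * (2 * (σ - f) * h)) * ‖u ω‖ ^ (2 * q)
      ≤ (1 + 2 * (σ - f) * h) ^ q * (‖u ω‖ ^ 2) ^ q := by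
        rw [pow_mul]
        exact mul_le_mul_of_nonneg_right (one_add_mul_le_pow (by linarith) q) (by positivity)
    _ = ((1 + 2 * (σ - f) * h) * ‖u ω‖ ^ 2) ^ q := (mul_pow _ _ _).symm
    _ ≤ _ := pow_le_pow_left₀ (by positivity) (hω.norm_sq_le hF hh) q

/-- A discrete Gronwall step with stable equilibrium. -/
theorem ennreal_le_of_mul_le {A c h K : ℝ} {x y b : ℝ≥0∞} (hA : 1 + (c + 1) * h ≤ A) (hc : 0 ≤ c)
    (hh : 0 ≤ h) (hstep : ENNReal.ofReal A * y ≤ ENNReal.ofReal (1 + c * h) * x +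
      ENNReal.ofReal (K * h)) (hx : x ≤ b) (hK : ENNReal.ofReal K ≤ b) : y ≤ b := by
  have hA0 : 0 < A := by have : 0 ≤ (c + 1) * h := by positivity
                         linarith
  have h1 : ENNReal.ofReal A * y ≤ ENNReal.ofReal A * b := by
    -- The source `K h` is at most `h b`, so one unit of the rate `c + 1` pays for it.
    calc _ ≤ ENNReal.ofReal (1 + c * h) * b + ENNReal.ofReal h * b := by
          refine hstep.trans (add_le_add (mul_le_mul_right hx _) ?_)
          rw [mul_comm, ENNReal.ofReal_mul hh]
          exact mul_le_mul_right hK _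
      _ = ENNReal.ofReal (1 + (c + 1) * h) * b := by
          rw [← add_mul, ← ENNReal.ofReal_add (by positivity) hh]
          ring_nf
      _ ≤ _ := by gcongr
  exact (ENNReal.mul_le_mul_iff_right (by simpa using hA0) ENNReal.ofReal_ne_top).1 h1

end Moments

/-! ## The semi-implicit Euler scheme -/

section Scheme

variable {Ω : Type*} {mΩ : MeasurableSpace Ω} {P : Measure Ω} {ℱ : Filtration ℝ≥0 mΩ}

theorem QWiener.isGaussianSeq {L : Type*} [NormedAddCommGroup L] [InnerProductSpace ℝ L]
    (W : QWiener P ℱ L) (s h : ℝ≥0) :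
    IsGaussianSeq P h fun j ω => W.β j (s + h) ω - W.β j s ω where
  measurable j := ((W.adapted j _).mono (ℱ.le _) le_rfl).sub
    ((W.adapted j _).mono (ℱ.le _) le_rfl)
  law j := by
    have h1 := ((W.brownian j).hasLaw_sub (s + h) s).map_eq
    have h2 : nndist (s + h).1 s.1 = h := by
      ext
      simp [NNReal.val_eq_coe]
    rw [h2] at h1
    exact h1
  indep := W.indep.comp (fun _ x => x (s + h) - x s) fun _ =>
    (measurable_pi_apply _).sub (measurable_pi_apply _)

theorem QWiener.indep_increment {L : Type*} [NormedAddCommGroup L] [InnerProductSpace ℝ L]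
    (W : QWiener P ℱ L) (s h : ℝ≥0) :
    Indep (MeasurableSpace.comap (fun ω j => W.β j (s + h) ω - W.β j s ω) MeasurableSpace.pi)
      (ℱ s) P :=
  W.indep_past s (s + h) le_self_add

theorem secondCountableTopology_fields (Θ : Set E3) : SecondCountableTopology (Fields Θ) := by
  have : Fact ((2 : ℝ≥0∞) ≠ ∞) := ⟨by simp⟩
  have : SecondCountableTopology (VecL2 Θ) := Lp.SecondCountableTopology
  exact WithLp.secondCountableTopology 2 _ _

variable {Θ : Set E3} {Q : Covariance (ScalarL2 Θ)} {W : QWiener P ℱ (ScalarL2 Θ)} {σ : ℝ}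
  {F : Fields Θ → Fields Θ} {B : Fields Θ → (Q.U0 →L[ℝ] Fields Θ)} {u₀ : Ω → Fields Θ} {h : ℝ≥0}

theorem IsSchemeSolution.exists_noise {u : ℕ → Ω → Fields Θ}
    (hu : IsSchemeSolution Q W σ F B u₀ h u) (k : ℕ) :
    ∃ N : Ω → Fields Θ, TendstoInMeasure P (fun n ω => ∑ j ∈ Finset.range n,
        (W.β j (k * h + h) ω - W.β j (k * h) ω) • B (u k ω) (Q.u0Basis W.e j)) atTop N ∧
      ∀ᵐ ω ∂P, IsStep F σ h (u k ω + N ω) (u (k + 1) ω) := by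
  obtain ⟨N, hN, hs⟩ := hu.step k
  refine ⟨N, ?_, ?_⟩
  · rw [IsNoiseTerm, add_one_mul] at hN
    exact hN
  · filter_upwards [hs] with ω ⟨w, hw, e⟩
    refine ⟨w, hw, ?_⟩
    rw [← sub_sub, e]
    abel

theorem IsSchemeSolution.ae_eq {α : ℝ}
    (hmono : ∀ u v, inner ℝ (u - v) (F u - F v) ≤ α * ‖u - v‖ ^ 2) (hσ : α ≤ σ)
    {u v : ℕ → Ω → Fields Θ} (hu : IsSchemeSolution Q W σ F B u₀ h u)
    (hv : IsSchemeSolution Q W σ F B u₀ h v) : ∀ᵐ ω ∂P, ∀ k, u k ω = v k ω := by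
  refine ae_all_iff.2 fun k => ?_
  induction k with
  | zero => exact hu.initial.trans hv.initial.symm
  | succ k ih =>
    obtain ⟨N, hN, hs⟩ := hu.exists_noise k
    obtain ⟨N', hN', hs'⟩ := hv.exists_noise k
    have hNN : N =ᵐ[P] N' := by
      refine tendstoInMeasure_ae_unique (hN.congr_left fun n => ?_) hN'
      filter_upwards [ih] with ω hω
      rw [hω]
    filter_upwards [ih, hNN, hs, hs'] with ω h1 h2 h3 h4
    have := h3.norm_sub_le hmono hσ h.coe_nonneg h4
    rw [h1, h2, sub_self, norm_zero] at this
    exact sub_eq_zero.1 (norm_le_zero_iff.1 this)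

theorem exists_isSchemeSolution [IsProbabilityMeasure P] {α a : ℝ}
    (hmono : ∀ u v, inner ℝ (u - v) (F u - F v) ≤ α * ‖u - v‖ ^ 2) (hσ : α ≤ σ)
    (hstep : ∀ g, ∃ u, IsStep F σ h g u) (hB : ∀ j, Continuous fun x => B x (Q.u0Basis W.e j))
    (hsum : ∀ x, hsNormSq (Q.u0Basis W.e) (B x) ≤ ENNReal.ofReal (2 * a ^ 2 * (1 + ‖x‖ ^ 2)))
    (hu₀ : StronglyMeasurable[ℱ 0] u₀) : ∃ u, IsSchemeSolution Q W σ F B u₀ h u := by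
  have := secondCountableTopology_fields Θ
  choose S hS using hstep
  have hSc : Continuous S := (LipschitzWith.of_dist_le_mul (K := 1) fun g g' => by
    rw [dist_eq_norm, dist_eq_norm, NNReal.coe_one, one_mul]
    exact (hS g).norm_sub_le hmono hσ h.coe_nonneg (hS g')).continuous
  -- The recursion carries measurability along in a subtype, since the noise at step `k` exists only
  -- for an iterate adapted to the past.
  have hnext : ∀ (k : ℕ) (v : {v : Ω → Fields Θ // StronglyMeasurable[ℱ (k * h)] v}),
      ∃ v' : {v : Ω → Fields Θ // StronglyMeasurable[ℱ ((k + 1 : ℕ) * h)] v},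
        ∃ N : Ω → Fields Θ,
          IsNoiseTerm Q W (k * h) ((k + 1) * h) (fun ω => B (v.1 ω)) N ∧
          ∀ ω, IsStep F σ h (v.1 ω + N ω) (v'.1 ω) := by
    rintro k ⟨v, hv⟩
    have hle : ℱ (k * h) ≤ ℱ (k * h + h) := ℱ.mono le_self_add
    obtain ⟨N, hNm, hN⟩ := StochMaxwell.exists_noise (Φ := fun x j => B x (Q.u0Basis W.e j)) hle
      (ℱ.le _) (W.isGaussianSeq (k * h) h)
      (fun j => (W.adapted j _).sub ((W.adapted j _).mono hle le_rfl))
      (W.indep_increment (k * h) h) hv hB hsum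
    refine ⟨⟨fun ω => S (v ω + N ω), ?_⟩, N, ?_, fun ω => hS _⟩
    · rw [Nat.cast_add, Nat.cast_one, add_one_mul]
      exact hSc.comp_stronglyMeasurable ((hv.mono hle).add hNm)
    · rw [IsNoiseTerm, add_one_mul]
      exact hN
  choose next hnext using hnext
  set U : ∀ k : ℕ, {v : Ω → Fields Θ // StronglyMeasurable[ℱ (k * h)] v} := fun k =>
    Nat.rec ⟨u₀, by rw [show ((Nat.zero : ℕ) : ℝ≥0) = 0 from Nat.cast_zero, zero_mul]; exact hu₀⟩ (fun k v => next k v) k with hU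
  refine ⟨fun k => (U k).1, fun k => (U k).2, ae_eq_refl _, fun k => ?_⟩
  obtain ⟨N, hN, hs⟩ := hnext k (U k)
  refine ⟨N, hN, Eventually.of_forall fun ω => ?_⟩
  obtain ⟨w, hw, e⟩ := hs ω
  refine ⟨w, hw, ?_⟩
  rw [← e, sub_add_eq_sub_sub, sub_add_cancel]

end Scheme

end StochMaxwell

/-! ### Well-posedness of the scheme and moment bounds uniform in time -/

open StochMaxwell in
theorem proposition3p1 (q : ℕ) (hq : 1 ≤ q) (σ₀ aF aB : ℝ) (hσ : aF + Rtilde q aB / q < σ₀) :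
    ∃ C : ℝ, 0 < C ∧ ∃ δ : ℝ≥0, 0 < δ ∧
      ∀ (Θ : Set E3), IsOpen Θ → IsConnected Θ → Bornology.IsBounded Θ →
      ∀ (Ω : Type*) (mΩ : MeasurableSpace Ω) (P : Measure Ω) (_ : IsProbabilityMeasure P)
        (ℱ : Filtration ℝ≥0 mΩ) (Q : Covariance (ScalarL2 Θ)) (W : QWiener P ℱ (ScalarL2 Θ))
        (Je Jm Jer Jmr : E3 → E3 → E3 → E3)
        (F : Fields Θ → Fields Θ) (B : Fields Θ → (Q.U0 →L[ℝ] Fields Θ))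
        (αF αB : ℝ) (u₀ : Ω → Fields Θ),
        IsCaratheodory Θ Je → IsCaratheodory Θ Jm →
        IsDriftNemytskij Je Jm F →
        IsDiffusionNemytskij Jer Jmr B →
        (∀ h, hsNormSq (Q.u0Basis W.e) (B h) ≠ ∞) →
        (∀ u v, inner ℝ (u - v) (F u - F v) ≤ αF * ‖u - v‖ ^ 2) →
        (∀ u v, hsNorm (Q.u0Basis W.e) (B u - B v) ≤ αB * ‖u - v‖) →
        aF = 1 / 2 * max (1 + 2 * αF) (‖F 0‖ ^ 2) →
        aB = max αB (hsNorm (Q.u0Basis W.e) (B 0)) →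
        StronglyMeasurable[ℱ 0] u₀ → MemLp u₀ (2 * q) P →
        ∀ Δt : ℝ≥0, 0 < Δt →
          (∃ u : ℕ → Ω → Fields Θ, IsSchemeSolution Q W σ₀ F B u₀ Δt u) ∧
          (∀ u v : ℕ → Ω → Fields Θ, IsSchemeSolution Q W σ₀ F B u₀ Δt u →
            IsSchemeSolution Q W σ₀ F B u₀ Δt v → ∀ᵐ ω ∂P, ∀ k, u k ω = v k ω) ∧
          (Δt < δ → ∀ u : ℕ → Ω → Fields Θ, IsSchemeSolution Q W σ₀ F B u₀ Δt u →
            ⨆ k, ∫⁻ ω, ‖u k ω‖ₑ ^ (2 * q) ∂P <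
              ENNReal.ofReal C * (1 + ∫⁻ ω, ‖u₀ ω‖ₑ ^ (2 * q) ∂P)) := by
  -- The constants are fixed before `aF` is known to be nonnegative, so `max aF 0` stands in for it;
  -- the two agree once `F` is given.
  obtain ⟨K, hK, δ, hδ, H⟩ := exists_lintegral_noise_le hq (a := aB) (le_max_right aF 0)
  refine ⟨K + 1, by positivity, ⟨δ, hδ.le⟩, hδ, ?_⟩
  intro Θ _ _ hΘ Ω mΩ P _ ℱ Q W Je Jm Jer Jmr F B αF αB u₀ hJe hJm hF _ hfin hmono hlip haF haB
    hu₀ hu₀Lp h hh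
  have := secondCountableTopology_fields Θ
  have hq0 : (0 : ℝ) < q := by exact_mod_cast hq
  have haF0 : 0 ≤ aF := by
    rw [haF]
    have := (sq_nonneg ‖F 0‖).trans (le_max_right (1 + 2 * αF) (‖F 0‖ ^ 2))
    linarith
  have hαF : 1 + 2 * αF ≤ 2 * aF := by
    rw [haF]
    linarith [le_max_left (1 + 2 * αF) (‖F 0‖ ^ 2)]
  have hαB : αB ≤ aB := haB ▸ le_max_left _ _
  have hB0 : hsNorm (Q.u0Basis W.e) (B 0) ≤ aB := haB ▸ le_max_right _ _
  have haB0 : 0 ≤ aB := (Real.sqrt_nonneg _).trans hB0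
  have hq1 : (1 : ℝ) ≤ q := by exact_mod_cast hq
  have hqq : (0 : ℝ) ≤ 2 * q - 1 := by linarith
  have hquad : 0 ≤ 4 * q * (2 * q - 1) * aB ^ 2 := by positivity
  have hrate : 1 + 4 * q * (2 * q - 1) * aB ^ 2 < q * (σ₀ - aF) := by
    have h1 : Rtilde q aB / q < σ₀ - aF := by linarith
    rw [div_lt_iff₀ hq0] at h1
    linarith [one_add_le_Rtilde hq haB0]
  have hσF : aF < σ₀ := by
    have : 0 < σ₀ - aF := pos_of_mul_pos_right (by linarith : 0 < q * (σ₀ - aF)) hq0.le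
    linarith
  have hσα : αF ≤ σ₀ := by linarith
  have hBc := continuous_apply_of_hsNorm_sub_le hfin hlip
  have hBs := hsNormSq_le hfin hlip hαB hB0
  refine ⟨exists_isSchemeSolution hmono hσα
    (fun g => exists_isStep hΘ hJe hJm hF hmono hσα (by exact_mod_cast hh) g) hBc hBs hu₀,
    fun u v hu hv => hu.ae_eq hmono hσα hv, fun hhδ u hu => ?_⟩
  rw [max_eq_left haF0] at H
  set m₀ := ∫⁻ ω, ‖u₀ ω‖ₑ ^ (2 * q) ∂P with hm₀
  have hm₀fin : m₀ ≠ ∞ := by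
    have h1 := eLpNorm_nnreal_pow_eq_lintegral (μ := P) (f := u₀) (p := 2 * q)
      (by exact_mod_cast (by omega : 2 * q ≠ 0))
    have h2 : (((2 * q : ℝ≥0) : ℝ)) = ((2 * q : ℕ) : ℝ) := by push_cast; rfl
    have h3 : ((2 * q : ℝ≥0) : ℝ≥0∞) = 2 * q := by push_cast; rfl
    simp only [h2, h3, ENNReal.rpow_natCast] at h1
    rw [hm₀, ← h1]
    exact ENNReal.pow_ne_top hu₀Lp.eLpNorm_lt_top.ne
  -- The bound is invariant under one step: it dominates both the current moment and `K`.
  have hle : ∀ k, ∫⁻ ω, ‖u k ω‖ₑ ^ (2 * q) ∂P ≤ m₀ + ENNReal.ofReal K := by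
    intro k
    induction k with
    | zero =>
      refine le_trans (le_of_eq (lintegral_congr_ae ?_)) le_self_add
      filter_upwards [hu.initial] with ω hω
      rw [hω]
    | succ k ih =>
      obtain ⟨N, hN, hs⟩ := hu.exists_noise k
      have h1 := H (Φ := fun x j => B x (Q.u0Basis W.e j)) (ℱ.le (k * h))
        (W.isGaussianSeq (k * h) h) hh hhδ (W.indep_increment (k * h) h) (hu.adapted k) hBc hBs hN
      have h2 := lintegral_norm_pow_le_of_isStep (inner_apply_le hmono haF) h.coe_nonneg hσF.le hs q
      have hc : 0 ≤ 1 + 2 * q * (2 * q - 1) * aB ^ 2 := by positivity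
      refine ennreal_le_of_mul_le ?_ hc h.coe_nonneg (h2.trans h1) ih le_add_self
      have h3 : 1 + 2 * q * (2 * q - 1) * aB ^ 2 + 1 ≤ q * (2 * (σ₀ - aF)) := by linarith
      have h4 := mul_le_mul_of_nonneg_right h3 h.coe_nonneg
      linarith
  refine (iSup_le hle).trans_lt ?_
  rw [ENNReal.ofReal_add hK zero_le_one, ENNReal.ofReal_one, mul_add, mul_one, add_mul, one_mul]
  -- The spare `1` in `C = K + 1` gives strict inequality; this needs `m₀` finite.
  calc m₀ + ENNReal.ofReal K < m₀ + ENNReal.ofReal K + 1 :=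
        ENNReal.lt_add_right (ENNReal.add_ne_top.2 ⟨hm₀fin, ENNReal.ofReal_ne_top⟩) one_ne_zero
    _ ≤ ENNReal.ofReal K + 1 + (ENNReal.ofReal K * m₀ + m₀) := by
        have : ENNReal.ofReal K + 1 + (ENNReal.ofReal K * m₀ + m₀) =
          m₀ + ENNReal.ofReal K + 1 + ENNReal.ofReal K * m₀ := by ring
        rw [this]
        exact le_self_add
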